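/- Let $d\ge 0$. For a polyhedron $P=\{x\in\mathbb R^d : a^i\cdot x\le b_i,\ 1\le i\le m\}$ with $a^i\in\mathbb R^d$, $b_i\in\mathbb R$, the data $(a^i,b_i)_{i\le m}$ is called an $\mathcal H$-representation of $P$. A $d$-dimensional polyhedron $P\subset\mathbb R^d$ is called simple if every $k$-dimensional face of $P$, $0\le k\le d-1$, belongs to exactly $d-k$ facets. It is called strongly simple if there is a projective transformation $f(x)=\dfrac{Ax+v}{c\cdot x+\delta}$, with $\begin{pmatrix}A&v\\ c^{\top}&\delta\end{pmatrix}$ invertible and $c\cdot x+\delta\ne 0$ for all $x\in P$, such that the closure of $f(P)$ is a $d$-dimensional simple polytope (a bounded polyhedron). Theorem. From an $\mathcal H$-representation of a $d$-dimensional strongly simple polyhedron $P\subset\mathbb R^d$ one can construct at most $d^d$ polynomials $\mathfrak p_1,\dots,\mathfrak p_l\in\mathbb R[x_1,\dots,x_d]$ (with $0^0=1$) such that $$P=\{x\in\mathbb R^d : \mathfrak p_1(x)\ge 0,\dots,\mathfrak p_l(x)\ge 0\}.$$ Here "construct" means that there is a single algorithm, for all $d$, $m$ and all such $P$, which takes $d$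 and the list of the $(a^i,b_i)$ as input and returns the polynomials as lists of coefficients and exponent vectors. The algorithm works in the real-number model of computation: it has exact addition, multiplication, negation and inversion of real numbers (with $0^{-1}=0$), the test $t>0$, and $1$ as its only real constant. Its control consists of composition, recursion on natural numbers and finite lists, and unbounded search that always terminates. -/

import Mathlib

/-! ### Polyhedra, faces, simple polytopes -/

/-- The polyhedron `{x ∈ ℝ^d : aⁱ · x ≤ b_i for all i}` described by the H-representation `(a, b)`. -/
def hPolyhedron {d m : ℕ} (a : Fin m → Fin d → ℝ) (b : Fin m → ℝ) : Set (Fin d → ℝ) :=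
  {x | ∀ i, a i ⬝ᵥ x ≤ b i}

/-- A polytope is a bounded polyhedron. -/
def IsPolytope {d : ℕ} (P : Set (Fin d → ℝ)) : Prop :=
  (∃ (m : ℕ) (a : Fin m → Fin d → ℝ) (b : Fin m → ℝ), P = hPolyhedron a b) ∧
    Bornology.IsBounded P

/-- `P` has affine dimension `k` (and is not empty). -/
def HasDim {d : ℕ} (P : Set (Fin d → ℝ)) (k : ℕ) : Prop :=
  P.Nonempty ∧ Module.finrank ℝ (vectorSpan ℝ P) = k

/-- `F` is a `k`-dimensional (nonempty) face of `P`: the set of maximizers over `P` of some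
linear functional. -/
def IsFaceOfDim {d : ℕ} (P : Set (Fin d → ℝ)) (k : ℕ) (F : Set (Fin d → ℝ)) : Prop :=
  IsExposed ℝ P F ∧ HasDim F k

/-- A `d`-dimensional `P ⊆ ℝ^d` is simple if for every `k < d` each `k`-dimensional face of `P` is
contained in exactly `d - k` facets, i.e. `(d - 1)`-dimensional faces. -/
def IsSimple {d : ℕ} (P : Set (Fin d → ℝ)) : Prop :=
  HasDim P d ∧
    ∀ k < d, ∀ F, IsFaceOfDim P k F → {G | IsFaceOfDim P (d - 1) G ∧ F ⊆ G}.encard = (d - k : ℕ)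

/-! ### Projective transformations, strongly simple polyhedra -/

/-- A projective transformation `x ↦ (A x + v) / (c · x + δ)` of `ℝ^d`, with invertible
homogeneous `(d + 1) × (d + 1)` matrix. -/
structure ProjTransformation (d : ℕ) where
  A : Matrix (Fin d) (Fin d) ℝ
  v : Fin d → ℝ
  c : Fin d → ℝ
  δ : ℝ
  det_ne_zero :
    (Matrix.fromBlocks A (Matrix.replicateCol Unit v) (Matrix.replicateRow Unit c)
      (Matrix.of fun _ _ : Unit => δ)).det ≠ 0

namespace ProjTransformation

/-- The denominator `c · x + δ`. -/
def denom {d : ℕ} (f : ProjTransformation d) (x : Fin d → ℝ) : ℝ := f.c ⬝ᵥ x + f.δ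

/-- The value at `x`, meaningful where the denominator does not vanish. -/
noncomputable def toFun {d : ℕ} (f : ProjTransformation d) (x : Fin d → ℝ) : Fin d → ℝ :=
  (f.denom x)⁻¹ • (f.A.mulVec x + f.v)

/-- `f` is permissible for `P` if `P` misses the hyperplane that `f` sends to infinity. -/
def Permissible {d : ℕ} (f : ProjTransformation d) (P : Set (Fin d → ℝ)) : Prop :=
  ∀ x ∈ P, f.denom x ≠ 0

end ProjTransformation

/-- `P` is strongly simple if for some `P`-permissible projective transformation `f` the closure of
`f(P)` is a (`d`-dimensional) simple polytope. -/
def IsStronglySimple {d : ℕ} (P : Set (Fin d → ℝ)) : Prop :=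
  ∃ f : ProjTransformation d, f.Permissible P ∧
    IsPolytope (closure (f.toFun '' P)) ∧ IsSimple (closure (f.toFun '' P))

/-! ### Algorithms over the real numbers -/

/-- Computability in the real-number model (real RAM, machines with exact real arithmetic), by
functions on structured data built from real numbers, natural numbers, pairs and lists.  The only
real constant is `1` (all others have to be computed from the input); the operations on real numbers
are `+`, `*`, `-`, inversion (with `0⁻¹ = 0`) and the test `0 < t`.  The discrete control is given by
composition, recursion on natural numbers and on lists, and unbounded search, which has to
terminate on every input. -/
inductive RealComputable : ∀ {α β : Type}, (α → β) → Prop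
  | id {α : Type} : RealComputable (fun a : α => a)
  | comp {α β γ : Type} {g : β → γ} {f : α → β} :
      RealComputable g → RealComputable f → RealComputable (fun a => g (f a))
  | pair {α β γ : Type} {f : α → β} {g : α → γ} :
      RealComputable f → RealComputable g → RealComputable (fun a => (f a, g a))
  | fst {α β : Type} : RealComputable (fun p : α × β => p.1)
  | snd {α β : Type} : RealComputable (fun p : α × β => p.2)
  | one {α : Type} : RealComputable (fun _ : α => (1 : ℝ))
  | add : RealComputable (fun p : ℝ × ℝ => p.1 + p.2)
  | mul : RealComputable (fun p : ℝ × ℝ => p.1 * p.2)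
  | neg : RealComputable (fun x : ℝ => -x)
  | inv : RealComputable (fun x : ℝ => x⁻¹)
  | branch {α β : Type} {t : α → ℝ} {f g : α → β} :
      RealComputable t → RealComputable f → RealComputable g →
      RealComputable (fun a => if 0 < t a then f a else g a)
  | zero {α : Type} : RealComputable (fun _ : α => (0 : ℕ))
  | succ : RealComputable (fun n : ℕ => n + 1)
  | natRec {α β : Type} {f : α → β} {g : α × ℕ × β → β} :
      RealComputable f → RealComputable g →
      RealComputable (fun p : α × ℕ =>
        Nat.rec (motive := fun _ => β) (f p.1) (fun n r => g (p.1, n, r)) p.2)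
  | nil {α β : Type} : RealComputable (fun _ : α => ([] : List β))
  | cons {β : Type} : RealComputable (fun p : β × List β => p.1 :: p.2)
  | listRec {α β γ : Type} {f : α → β} {g : α × γ × List γ × β → β} :
      RealComputable f → RealComputable g →
      RealComputable (fun p : α × List γ =>
        List.rec (motive := fun _ => β) (f p.1) (fun x l r => g (p.1, x, l, r)) p.2)
  | search {α : Type} {t : α × ℕ → ℝ} {f : α → ℕ} :
      RealComputable t → (∀ a, 0 < t (a, f a) ∧ ∀ n < f a, ¬ 0 < t (a, n)) →
      RealComputable f

/-! ### Input and output of the construction -/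

/-- The H-representation `(a, b)` as data: the list of the pairs `(aⁱ, b_i)`. -/
def encodeH {d m : ℕ} (a : Fin m → Fin d → ℝ) (b : Fin m → ℝ) : List (List ℝ × ℝ) :=
  List.ofFn fun i => (List.ofFn (a i), b i)

/-- The polynomial in `d` variables given by a list of terms (coefficient, exponents): the term
`(r, [e₀, e₁, …])` stands for `r * X₀ ^ e₀ * X₁ ^ e₁ * ⋯`, where missing exponents are `0` and
exponents in excess of `d` are ignored. -/
noncomputable def decodePoly (d : ℕ) (p : List (ℝ × List ℕ)) : MvPolynomial (Fin d) ℝ :=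
  (p.map fun t => MvPolynomial.C t.1 * ∏ i : Fin d, MvPolynomial.X i ^ t.2.getD i 0).sum

/-- The closed semi-algebraic set `{x : 𝔭(x) ≥ 0 for all 𝔭 in the list}`. -/
def polySet {d : ℕ} (ps : List (MvPolynomial (Fin d) ℝ)) : Set (Fin d → ℝ) :=
  {x | ∀ p ∈ ps, 0 ≤ MvPolynomial.eval x p}

/-!
# Polynomial inequalities for strongly simple polyhedra

Let `L₁, …, L_m` be an irredundant system of linear forms which defines the closed cone over
`P × {1}` in `ℝ ^ (d + 1)`; the form `s` (the last homogeneous coordinate) belongs to the system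
before redundant forms are removed, so that points at infinity are included.  A permissible projective
transformation extends to a linear automorphism of `ℝ ^ (d + 1)`, and the closure of the image of `P`
is a bounded section of the cone.  Since this section is a simple polytope, at most `d` of the forms
vanish at a nonzero point of the cone (`IsStronglySimple.encard_active_le`): the forms which vanish
there define distinct facets through a common face.

For `d ≥ 2`, the polyhedron is described by the dehomogenizations of `d + 2 ≤ d ^ d` polynomials: the
elementary symmetric polynomials of degrees `m, …, m - d + 1` in the forms, their sum `σ`, and
`q = m σ ^ (2 k) - ∑ (2 L_i - σ) ^ (2 k)` for a large `k`.

* If `σ = 1`, then `q ≥ 0` forces `-η ≤ L_i ≤ 1 + η` with `η → 0` as `k → ∞`, by Bernoulli's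
  inequality; on the cone, where `0 ≤ L_i ≤ σ`, `q` is nonnegative.
* If `η` is small, then at most `d` of the forms are less than a fixed `δ > 0` at such a point
  (`LinForm.exists_of_margin`).  The symmetric polynomials are the lowest `d` coefficients of
  `∏ (t + L_i)`, and the next coefficient is bounded below in terms of `δ`.  So there is no small
  positive root `t`, that is, no form is negative (`List.nonneg_of_coSym_nonneg`).

For `d = 1` the product of the forms suffices (`nonneg_of_prod_nonneg`), and for `d = 0` nothing is
needed.

Everything is computed by Fourier–Motzkin elimination (`LinForm.elim_iff`).  It decides whether a form
is redundant.  To find `δ`, the elimination is carried out with a parameter `ε`: for a set `I` of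
forms, the system `σ ≥ 1`, `L_i ≥ -ε`, `L_i ≤ ε` for `i ∈ I` reduces to finitely many inequalities
`α + β ε ≥ 0`, and if it is infeasible for `ε = 0`, one of them has `α < 0`, which yields an explicit
bound below which it remains infeasible.  Only the exponent `k` is found by search, which ends
on every input because `η` is always positive.
-/

/-! ### Programming with real-number computable functions -/

namespace RealComputable

variable {α β γ : Type}

theorem comp_fst {f : α → β} (hf : RealComputable f) :
    RealComputable (fun p : α × γ => f p.1) := comp hf fst

theorem fst_of {f : α → β × γ} (hf : RealComputable f) : RealComputable (fun a => (f a).1) :=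
  comp fst hf

theorem snd_of {f : α → β × γ} (hf : RealComputable f) : RealComputable (fun a => (f a).2) :=
  comp snd hf

theorem add_of {f g : α → ℝ} (hf : RealComputable f) (hg : RealComputable g) :
    RealComputable (fun a => f a + g a) := comp add (pair hf hg)

theorem mul_of {f g : α → ℝ} (hf : RealComputable f) (hg : RealComputable g) :
    RealComputable (fun a => f a * g a) := comp mul (pair hf hg)

theorem neg_of {f : α → ℝ} (hf : RealComputable f) : RealComputable (fun a => -f a) :=
  comp neg hf

theorem sub_of {f g : α → ℝ} (hf : RealComputable f) (hg : RealComputable g) :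
    RealComputable (fun a => f a - g a) := by
  simpa only [sub_eq_add_neg] using add_of hf (neg_of hg)

theorem const_zero : RealComputable (fun _ : α => (0 : ℝ)) := by
  simpa only [sub_self] using sub_of (α := α) one one

theorem const_two : RealComputable (fun _ : α => (2 : ℝ)) := by
  simpa only [one_add_one_eq_two] using add_of (α := α) one one

theorem div_of {f g : α → ℝ} (hf : RealComputable f) (hg : RealComputable g) :
    RealComputable (fun a => f a / g a) := by
  simpa only [div_eq_mul_inv] using mul_of hf (comp inv hg)

theorem succ_of {f : α → ℕ} (hf : RealComputable f) : RealComputable (fun a => f a + 1) :=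
  comp succ hf

theorem const_nat (n : ℕ) : RealComputable (fun _ : α => n) := by
  induction n with
  | zero => exact zero
  | succ n ih => exact succ_of ih

theorem natRec_of {f : α → β} {g : α → ℕ → β → β} {n : α → ℕ} (hf : RealComputable f)
    (hg : RealComputable (fun p : α × ℕ × β => g p.1 p.2.1 p.2.2)) (hn : RealComputable n) :
    RealComputable (fun a => Nat.rec (motive := fun _ => β) (f a) (g a) (n a)) :=
  comp (natRec hf hg) (pair id hn)

theorem listRec_of {f : α → β} {g : α → γ → List γ → β → β} {l : α → List γ}
    (hf : RealComputable f)
    (hg : RealComputable (fun p : α × γ × List γ × β => g p.1 p.2.1 p.2.2.1 p.2.2.2))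
    (hl : RealComputable l) :
    RealComputable (fun a => List.rec (motive := fun _ => β) (f a) (g a) (l a)) :=
  comp (listRec hf hg) (pair id hl)

theorem foldr_of {f : α → β} {g : α → γ → β → β} {l : α → List γ}
    (hf : RealComputable f) (hg : RealComputable (fun p : α × γ × β => g p.1 p.2.1 p.2.2))
    (hl : RealComputable l) : RealComputable (fun a => (l a).foldr (g a) (f a)) := by
  have h : (fun a => (l a).foldr (g a) (f a)) = fun a =>
      List.rec (motive := fun _ => β) (f a) (fun x _ r => g a x r) (l a) := by
    funext a
    induction l a with
    | nil => rfl
    | cons x l ih => rw [List.foldr_cons, ih]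
  rw [h]
  exact listRec_of hf
    (comp hg (pair fst (pair (fst_of snd) (snd_of (snd_of snd))))) hl

theorem natCast_of {n : α → ℕ} (hn : RealComputable n) :
    RealComputable (fun a => (n a : ℝ)) := by
  have h : (fun a => (n a : ℝ)) = fun a =>
      Nat.rec (motive := fun _ => ℝ) (0 : ℝ) (fun _ r => r + 1) (n a) := by
    funext a
    induction n a with
    | zero => simp
    | succ n ih => rw [Nat.cast_succ, ih]
  rw [h]
  exact natRec_of const_zero (add_of (snd_of snd) one) hn

theorem natAdd_of {m n : α → ℕ} (hm : RealComputable m) (hn : RealComputable n) :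
    RealComputable (fun a => m a + n a) := by
  have h : (fun a => m a + n a) = fun a =>
      Nat.rec (motive := fun _ => ℕ) (m a) (fun _ r => r + 1) (n a) := by
    funext a
    induction n a with
    | zero => rfl
    | succ n ih => rw [← Nat.add_assoc, ih]
  rw [h]
  exact natRec_of hm (succ_of (snd_of snd)) hn

theorem pow_of {f : α → ℝ} {n : α → ℕ} (hf : RealComputable f) (hn : RealComputable n) :
    RealComputable (fun a => f a ^ n a) := by
  have h : (fun a => f a ^ n a) = fun a =>
      Nat.rec (motive := fun _ => ℝ) (1 : ℝ) (fun _ r => r * f a) (n a) := by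
    funext a
    induction n a with
    | zero => simp
    | succ n ih => rw [pow_succ, ih]
  rw [h]
  exact natRec_of one (mul_of (snd_of snd) (comp_fst hf)) hn

theorem ite_natEq {m n : α → ℕ} {f g : α → β} (hm : RealComputable m) (hn : RealComputable n)
    (hf : RealComputable f) (hg : RealComputable g) :
    RealComputable (fun a => if m a = n a then f a else g a) := by
  have h : (fun a => if m a = n a then f a else g a) = fun a =>
      if 0 < (m a : ℝ) - n a then g a else if 0 < (n a : ℝ) - m a then g a else f a := by
    funext a
    rcases lt_trichotomy (m a) (n a) with h | h | h
    · have : (m a : ℝ) < n a := by exact_mod_cast h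
      rw [if_neg h.ne, if_neg (by linarith), if_pos (by linarith)]
    · simp [h]
    · have : (n a : ℝ) < m a := by exact_mod_cast h
      rw [if_neg h.ne', if_pos (by linarith)]
  rw [h]
  exact branch (sub_of (natCast_of hm) (natCast_of hn)) hg
    (branch (sub_of (natCast_of hn) (natCast_of hm)) hg hf)

theorem cons_of {f : α → β} {l : α → List β} (hf : RealComputable f) (hl : RealComputable l) :
    RealComputable (fun a => f a :: l a) := comp cons (pair hf hl)

theorem singleton_of {f : α → β} (hf : RealComputable f) : RealComputable (fun a => [f a]) :=
  cons_of hf nil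

theorem append_of {l m : α → List β} (hl : RealComputable l) (hm : RealComputable m) :
    RealComputable (fun a => l a ++ m a) := by
  have h : (fun a => l a ++ m a) = fun a => (l a).foldr (fun x r => x :: r) (m a) := by
    funext a; simp
  rw [h]
  exact foldr_of hm (cons_of (fst_of snd) (snd_of snd)) hl

theorem map_of {g : α → β → γ} {l : α → List β}
    (hg : RealComputable (fun p : α × β => g p.1 p.2)) (hl : RealComputable l) :
    RealComputable (fun a => (l a).map (g a)) := by
  have h : (fun a => (l a).map (g a)) = fun a => (l a).foldr (fun x r => g a x :: r) [] := by
    funext a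
    induction l a with
    | nil => rfl
    | cons x l ih => rw [List.map_cons, ih, List.foldr_cons]
  rw [h]
  exact foldr_of nil (cons_of (comp hg (pair fst (fst_of snd))) (snd_of snd)) hl

theorem flatMap_of {g : α → β → List γ} {l : α → List β}
    (hg : RealComputable (fun p : α × β => g p.1 p.2)) (hl : RealComputable l) :
    RealComputable (fun a => (l a).flatMap (g a)) := by
  have h : (fun a => (l a).flatMap (g a)) = fun a =>
      (l a).foldr (fun x r => g a x ++ r) [] := by
    funext a
    induction l a with
    | nil => rfl
    | cons x l ih => rw [List.flatMap_cons, ih, List.foldr_cons]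
  rw [h]
  exact foldr_of nil (append_of (comp hg (pair fst (fst_of snd))) (snd_of snd)) hl

theorem flatten_of {l : α → List (List β)} (hl : RealComputable l) :
    RealComputable (fun a => (l a).flatten) := by
  have h : (fun a => (l a).flatten) = fun a => (l a).flatMap (fun x => x) := by
    funext a; simp
  rw [h]
  exact flatMap_of snd hl

theorem sum_of {l : α → List ℝ} (hl : RealComputable l) :
    RealComputable (fun a => (l a).sum) := by
  have h : (fun a => (l a).sum) = fun a => (l a).foldr (fun x r => x + r) (0 : ℝ) := by
    funext a; simp [List.sum]
  rw [h]
  exact foldr_of const_zero (add_of (fst_of snd) (snd_of snd)) hl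

theorem length_of {l : α → List β} (hl : RealComputable l) :
    RealComputable (fun a => (l a).length) := by
  have h : (fun a => (l a).length) = fun a => (l a).foldr (fun _ r => r + 1) 0 := by
    funext a
    induction l a with
    | nil => rfl
    | cons x l ih => rw [List.length_cons, ih, List.foldr_cons]
  rw [h]
  exact foldr_of zero (succ_of (snd_of snd)) hl

theorem range_of {n : α → ℕ} (hn : RealComputable n) :
    RealComputable (fun a => List.range (n a)) := by
  have h : (fun a => List.range (n a)) = fun a =>
      Nat.rec (motive := fun _ => List ℕ) [] (fun k r => r ++ [k]) (n a) := by
    funext a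
    induction n a with
    | zero => rfl
    | succ n ih => rw [List.range_succ, ih]
  rw [h]
  exact natRec_of nil (append_of (snd_of snd) (singleton_of (fst_of snd))) hn

theorem count_of {n : α → ℕ} {l : α → List ℕ} (hn : RealComputable n) (hl : RealComputable l) :
    RealComputable (fun a => (l a).count (n a)) := by
  have h : (fun a => (l a).count (n a)) = fun a =>
      (l a).foldr (fun x r => if x = n a then r + 1 else r) 0 := by
    funext a
    induction l a with
    | nil => rfl
    | cons x l ih =>
      rw [List.count_cons, ih, List.foldr_cons]
      by_cases hx : x = n a <;> simp [hx]
  rw [h]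
  exact foldr_of zero (ite_natEq (fst_of snd) (comp_fst hn) (succ_of (snd_of snd))
    (snd_of snd)) hl

theorem sublists'_of {l : α → List β} (hl : RealComputable l) :
    RealComputable (fun a => (l a).sublists') := by
  have h : (fun a => (l a).sublists') = fun a =>
      (l a).foldr (fun x r => r ++ r.map (fun y => x :: y)) [[]] := by
    funext a
    induction l a with
    | nil => rfl
    | cons x l ih => rw [List.sublists'_cons, ih, List.foldr_cons]
  rw [h]
  exact foldr_of (singleton_of nil) (append_of (snd_of snd)
    (map_of (cons_of (fst_of (snd_of fst)) snd) (snd_of snd))) hl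

end RealComputable

/-! ### Linear forms and Fourier–Motzkin elimination -/

/-- A linear form in the variables `u₀, u₁, …`, as a list of terms (coefficient, index of the
variable).  An index may occur repeatedly, so that the sum of two forms is their concatenation. -/
abbrev LinForm := List (ℝ × ℕ)

namespace LinForm

/-- The value of a form at `u`. -/
def eval (u : ℕ → ℝ) (l : LinForm) : ℝ := (l.map fun t => t.1 * u t.2).sum

/-- The total coefficient of the variable `u_k`. -/
def coef (k : ℕ) (l : LinForm) : ℝ := (l.map fun t => if t.2 = k then t.1 else 0).sum

/-- Multiplication of a form by a scalar. -/
def scale (r : ℝ) (l : LinForm) : LinForm := l.map fun t => (r * t.1, t.2)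

/-- All variables of the form have index less than `N`. -/
def SuppBelow (N : ℕ) (l : LinForm) : Prop := ∀ t ∈ l, t.2 < N

theorem eval_cons (u : ℕ → ℝ) (t : ℝ × ℕ) (l : LinForm) :
    eval u (t :: l) = t.1 * u t.2 + eval u l := by simp [eval]

theorem coef_cons (k : ℕ) (t : ℝ × ℕ) (l : LinForm) :
    coef k (t :: l) = (if t.2 = k then t.1 else 0) + coef k l := by simp [coef]

theorem eval_append (u : ℕ → ℝ) (l m : LinForm) : eval u (l ++ m) = eval u l + eval u m := by
  simp [eval]

theorem eval_scale (u : ℕ → ℝ) (r : ℝ) (l : LinForm) : eval u (scale r l) = r * eval u l := by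
  induction l with
  | nil => simp [scale, eval]
  | cons t l ih =>
    have : scale r (t :: l) = (r * t.1, t.2) :: scale r l := rfl
    rw [this, eval_cons, eval_cons, ih]
    ring

theorem eval_flatten (u : ℕ → ℝ) (ls : List LinForm) :
    eval u ls.flatten = (ls.map (eval u)).sum := by
  induction ls with
  | nil => rfl
  | cons l ls ih => rw [List.flatten_cons, eval_append, ih, List.map_cons, List.sum_cons]

theorem eval_update (u : ℕ → ℝ) (k : ℕ) (s : ℝ) (l : LinForm) :
    eval (Function.update u k s) l = eval u l + coef k l * (s - u k) := by
  induction l with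
  | nil => simp [eval, coef]
  | cons t l ih =>
    rw [eval_cons, eval_cons, coef_cons, ih]
    by_cases h : t.2 = k
    · rw [h, if_pos rfl, Function.update_self]
      ring
    · rw [if_neg h, Function.update_of_ne h]
      ring

theorem eval_congr {N : ℕ} {u v : ℕ → ℝ} {l : LinForm} (hl : SuppBelow N l)
    (h : ∀ i < N, u i = v i) : eval u l = eval v l := by
  unfold eval
  congr 1
  exact List.map_congr_left fun t ht => by rw [h _ (hl t ht)]

theorem eval_smul (r : ℝ) (u : ℕ → ℝ) (l : LinForm) : eval (r • u) l = r * eval u l := by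
  induction l with
  | nil => simp [eval]
  | cons t l ih =>
    rw [eval_cons, eval_cons, ih, Pi.smul_apply, smul_eq_mul]
    ring

theorem eval_add (u v : ℕ → ℝ) (l : LinForm) : eval (u + v) l = eval u l + eval v l := by
  induction l with
  | nil => simp [eval]
  | cons t l ih =>
    rw [eval_cons, eval_cons, eval_cons, ih, Pi.add_apply]
    ring

/-- The positive combination of `p` and `n` in which `u_k` cancels, if the coefficient of `u_k` is
positive in `p` and negative in `n`. -/
def cancel (k : ℕ) (p n : LinForm) : LinForm := scale (coef k p) n ++ scale (-coef k n) p

/-- One step of Fourier–Motzkin elimination: from the inequalities `0 ≤ c`, `c ∈ cs`, to those which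
say that they can be satisfied by a change of `u_k`. -/
noncomputable def fmStep (k : ℕ) (cs : List LinForm) : List LinForm :=
  (cs.flatMap fun c => if 0 < coef k c then [] else if 0 < -coef k c then [] else [c]) ++
    cs.flatMap fun p => cs.flatMap fun n =>
      if 0 < coef k p then (if 0 < -coef k n then [cancel k p n] else []) else []

theorem mem_fmStep {k : ℕ} {cs : List LinForm} {c : LinForm} :
    c ∈ fmStep k cs ↔ (c ∈ cs ∧ coef k c = 0) ∨
      ∃ p ∈ cs, ∃ n ∈ cs, 0 < coef k p ∧ coef k n < 0 ∧ c = cancel k p n := by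
  unfold fmStep
  rw [List.mem_append, List.mem_flatMap, List.mem_flatMap]
  refine or_congr ⟨?_, ?_⟩ ⟨?_, ?_⟩
  · rintro ⟨c', hc', h⟩
    split_ifs at h with h1 h2
    · simp at h
    · simp at h
    · rw [List.mem_singleton] at h
      subst h
      exact ⟨hc', by linarith⟩
  · rintro ⟨hc, h⟩
    exact ⟨c, hc, by simp [h]⟩
  · rintro ⟨p, hp, h⟩
    obtain ⟨n, hn, h⟩ := List.mem_flatMap.1 h
    split_ifs at h with h1 h2
    · exact ⟨p, hp, n, hn, h1, by linarith, List.mem_singleton.1 h⟩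
    · simp at h
    · simp at h
  · rintro ⟨p, hp, n, hn, h1, h2, rfl⟩
    refine ⟨p, hp, List.mem_flatMap.2 ⟨n, hn, ?_⟩⟩
    rw [if_pos h1, if_pos (by linarith)]
    simp

theorem exists_between_lists (lo hi : List ℝ) (h : ∀ a ∈ lo, ∀ b ∈ hi, a ≤ b) :
    ∃ s, (∀ a ∈ lo, a ≤ s) ∧ ∀ b ∈ hi, s ≤ b := by
  induction lo with
  | nil =>
    obtain ⟨s, hs⟩ := (List.finite_toSet hi).bddBelow
    exact ⟨s, by simp, fun b hb => hs hb⟩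
  | cons a lo ih =>
    obtain ⟨s, h1, h2⟩ := ih fun a' ha' => h a' (List.mem_cons_of_mem _ ha')
    refine ⟨max a s, fun a' ha' => ?_, fun b hb => max_le (h a List.mem_cons_self b hb) (h2 b hb)⟩
    rcases List.mem_cons.1 ha' with rfl | ha'
    · exact le_max_left _ _
    · exact (h1 a' ha').trans (le_max_right _ _)

theorem fmStep_iff (k : ℕ) (cs : List LinForm) (u : ℕ → ℝ) :
    (∀ c ∈ fmStep k cs, 0 ≤ eval u c) ↔
      ∃ s, ∀ c ∈ cs, 0 ≤ eval (Function.update u k s) c := by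
  constructor
  · intro h
    -- A form with coefficient `a ≠ 0` at `u_k` and value `r` is nonnegative if `s` lies on the
    -- correct side of `u k - r / a`.
    let root : LinForm → ℝ := fun c => u k - eval u c / coef k c
    obtain ⟨s, hlo, hhi⟩ := exists_between_lists
      ((cs.filter fun c => 0 < coef k c).map root) ((cs.filter fun c => coef k c < 0).map root)
      (by
        intro a ha b hb
        obtain ⟨p, hp, rfl⟩ := List.mem_map.1 ha
        obtain ⟨n, hn, rfl⟩ := List.mem_map.1 hb
        obtain ⟨hp, hp'⟩ := List.mem_filter.1 hp
        obtain ⟨hn, hn'⟩ := List.mem_filter.1 hn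
        have hp' : 0 < coef k p := by simpa using hp'
        have hn' : coef k n < 0 := by simpa using hn'
        have := h _ (mem_fmStep.2 (Or.inr ⟨p, hp, n, hn, hp', hn', rfl⟩))
        rw [cancel, eval_append, eval_scale, eval_scale] at this
        have key : eval u n / coef k n ≤ eval u p / coef k p := by
          rw [← sub_nonneg, div_sub_div _ _ hp'.ne' hn'.ne]
          exact div_nonneg_of_nonpos (by linarith) (mul_neg_of_pos_of_neg hp' hn').le
        simp only [root]
        linarith)
    refine ⟨s, fun c hc => ?_⟩
    rw [eval_update]
    rcases lt_trichotomy (coef k c) 0 with h0 | h0 | h0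
    · have := hhi (root c) (List.mem_map.2 ⟨c, List.mem_filter.2 ⟨hc, by simpa using h0⟩, rfl⟩)
      have h1 : coef k c * (u k - eval u c / coef k c) ≤ coef k c * s :=
        mul_le_mul_of_nonpos_left this h0.le
      rw [mul_sub, mul_div_cancel₀ _ h0.ne] at h1
      linarith
    · have := h _ (mem_fmStep.2 (Or.inl ⟨hc, h0⟩))
      rw [h0]
      linarith
    · have := hlo (root c) (List.mem_map.2 ⟨c, List.mem_filter.2 ⟨hc, by simpa using h0⟩, rfl⟩)
      have h1 : coef k c * (u k - eval u c / coef k c) ≤ coef k c * s :=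
        mul_le_mul_of_nonneg_left this h0.le
      rw [mul_sub, mul_div_cancel₀ _ h0.ne'] at h1
      linarith
  · rintro ⟨s, hs⟩ c hc
    rcases mem_fmStep.1 hc with ⟨hc, h0⟩ | ⟨p, hp, n, hn, hp', hn', rfl⟩
    · have := hs c hc
      rw [eval_update, h0] at this
      linarith
    · have h1 := hs p hp
      have h2 := hs n hn
      rw [eval_update] at h1 h2
      rw [cancel, eval_append, eval_scale, eval_scale]
      nlinarith [mul_nonneg hp'.le h2, mul_nonneg (neg_nonneg.2 hn'.le) h1]

/-- Elimination of the variables `u₀, …, u_{n-1}`. -/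
noncomputable def elim (n : ℕ) (cs : List LinForm) : List LinForm :=
  Nat.rec (motive := fun _ => List LinForm) cs (fun k r => fmStep k r) n

theorem elim_iff (n : ℕ) (cs : List LinForm) (u : ℕ → ℝ) :
    (∀ c ∈ elim n cs, 0 ≤ eval u c) ↔
      ∃ v : ℕ → ℝ, (∀ k, n ≤ k → v k = u k) ∧ ∀ c ∈ cs, 0 ≤ eval v c := by
  induction n generalizing u with
  | zero =>
    constructor
    · exact fun h => ⟨u, fun _ _ => rfl, h⟩
    · rintro ⟨v, hv, h⟩
      rwa [← show v = u from funext fun k => hv k (Nat.zero_le k)]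
  | succ n ih =>
    change (∀ c ∈ fmStep n (elim n cs), 0 ≤ eval u c) ↔ _
    rw [fmStep_iff]
    simp only [ih]
    constructor
    · rintro ⟨s, v, hv, h⟩
      refine ⟨v, fun k hk => ?_, h⟩
      rw [hv k (by omega), Function.update_of_ne (by omega)]
    · rintro ⟨v, hv, h⟩
      refine ⟨v n, v, fun k hk => ?_, h⟩
      rcases hk.eq_or_lt with rfl | hk'
      · rw [Function.update_self]
      · rw [Function.update_of_ne hk'.ne', hv k hk']

/-- The point with `u_N = 1`, `u_{N+1} = ε` and all other coordinates zero.  In the systems below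
the forms live on `u₀, …, u_{N-1}`, while `u_N` carries the constant terms and `u_{N+1}` a
parameter. -/
def paramPoint (N : ℕ) (ε : ℝ) : ℕ → ℝ := fun i => if i = N then 1 else if i = N + 1 then ε else 0

theorem paramPoint_self (N : ℕ) (ε : ℝ) : paramPoint N ε N = 1 := if_pos rfl

theorem paramPoint_succ (N : ℕ) (ε : ℝ) : paramPoint N ε (N + 1) = ε := by
  simp [paramPoint]

theorem eval_paramPoint (N : ℕ) (ε : ℝ) (l : LinForm) :
    eval (paramPoint N ε) l = coef N l + ε * coef (N + 1) l := by
  induction l with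
  | nil => simp [eval, coef]
  | cons t l ih =>
    rw [eval_cons, coef_cons, coef_cons, ih, paramPoint]
    by_cases h : t.2 = N
    · simp [h]
      ring
    · by_cases h' : t.2 = N + 1
      · simp [h']
        ring
      · simp [h, h']

theorem elim_paramPoint_iff (N : ℕ) (cs : List LinForm) (ε : ℝ) :
    (∀ c ∈ elim N cs, 0 ≤ coef N c + ε * coef (N + 1) c) ↔
      ∃ v : ℕ → ℝ, (∀ k, N ≤ k → v k = paramPoint N ε k) ∧ ∀ c ∈ cs, 0 ≤ eval v c := by
  simp only [← eval_paramPoint]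
  exact elim_iff N cs _

end LinForm

namespace RealComputable

variable {α : Type}

open LinForm

theorem coef_of {k : α → ℕ} {l : α → LinForm} (hk : RealComputable k) (hl : RealComputable l) :
    RealComputable (fun a => coef (k a) (l a)) :=
  sum_of (map_of (ite_natEq (snd_of snd) (comp_fst hk) (fst_of snd) const_zero) hl)

theorem scale_of {r : α → ℝ} {l : α → LinForm} (hr : RealComputable r) (hl : RealComputable l) :
    RealComputable (fun a => scale (r a) (l a)) :=
  map_of (pair (mul_of (comp_fst hr) (fst_of snd)) (snd_of snd)) hl

theorem cancel_of {k : α → ℕ} {p n : α → LinForm} (hk : RealComputable k) (hp : RealComputable p)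
    (hn : RealComputable n) : RealComputable (fun a => cancel (k a) (p a) (n a)) :=
  append_of (scale_of (coef_of hk hp) hn) (scale_of (neg_of (coef_of hk hn)) hp)

theorem fmStep_of {k : α → ℕ} {cs : α → List LinForm} (hk : RealComputable k)
    (hcs : RealComputable cs) : RealComputable (fun a => fmStep (k a) (cs a)) :=
  append_of
    (flatMap_of (branch (coef_of (comp_fst hk) snd) nil
      (branch (neg_of (coef_of (comp_fst hk) snd)) nil (singleton_of snd))) hcs)
    (flatMap_of (flatMap_of
      (branch (coef_of (comp_fst (comp_fst hk)) (snd_of fst))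
        (branch (neg_of (coef_of (comp_fst (comp_fst hk)) snd))
          (singleton_of (cancel_of (comp_fst (comp_fst hk)) (snd_of fst) snd)) nil) nil)
      (comp_fst hcs)) hcs)

theorem elim_of {n : α → ℕ} {cs : α → List LinForm} (hn : RealComputable n)
    (hcs : RealComputable cs) : RealComputable (fun a => elim (n a) (cs a)) :=
  natRec_of hcs (fmStep_of (fst_of snd) (snd_of snd)) hn

end RealComputable

/-! ### Irredundant systems -/

namespace LinForm

/-- The system `0 ≤ w` for `w ∈ rest` and `v ≤ -1` (the `1` being carried by the variable `u_N`). -/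
noncomputable def refuteSystem (N : ℕ) (v : LinForm) (rest : List LinForm) : List LinForm :=
  ((-1, N) :: scale (-1) v) :: rest

/-- Positive if and only if some form has a negative coefficient at `u_N`. -/
noncomputable def violation (N : ℕ) (cs : List LinForm) : ℝ :=
  cs.foldr (fun c r => if 0 < -coef N c then 1 else r) 0

theorem violation_pos {N : ℕ} {cs : List LinForm} :
    0 < violation N cs ↔ ∃ c ∈ cs, coef N c < 0 := by
  induction cs with
  | nil => simp [violation]
  | cons c cs ih =>
    have : violation N (c :: cs) = if 0 < -coef N c then 1 else violation N cs := rfl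
    rw [this]
    split_ifs with h
    · simp only [zero_lt_one, true_iff]
      exact ⟨c, List.mem_cons_self, by linarith⟩
    · rw [ih]
      simp only [List.mem_cons, exists_eq_or_imp]
      exact ⟨Or.inr, fun h' => h'.resolve_left (by linarith)⟩

theorem exists_of_not_violation {N : ℕ} {v : LinForm} {rest : List LinForm}
    (h : ¬ 0 < violation N (elim N (refuteSystem N v rest))) :
    ∃ u, eval u v < 0 ∧ ∀ w ∈ rest, 0 ≤ eval u w := by
  rw [violation_pos] at h
  push Not at h
  obtain ⟨u, hu, hc⟩ := (elim_paramPoint_iff N (refuteSystem N v rest) 0).1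
    fun c hc => by simpa using h c hc
  refine ⟨u, ?_, fun w hw => hc w (List.mem_cons_of_mem _ hw)⟩
  have := hc _ List.mem_cons_self
  rw [eval_cons, eval_scale, hu N le_rfl, paramPoint_self] at this
  linarith

theorem nonneg_of_violation {N : ℕ} {v : LinForm} {rest : List LinForm} (hv : SuppBelow N v)
    (hrest : ∀ w ∈ rest, SuppBelow N w)
    (h : 0 < violation N (elim N (refuteSystem N v rest))) {u : ℕ → ℝ}
    (hu : ∀ w ∈ rest, 0 ≤ eval u w) : 0 ≤ eval u v := by
  by_contra hneg
  push Not at hneg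
  obtain ⟨c, hc, hlt⟩ := violation_pos.1 h
  have hr : 0 ≤ (-eval u v)⁻¹ := inv_nonneg.2 (by linarith)
  let u' : ℕ → ℝ := fun i => if i < N then ((-eval u v)⁻¹ • u) i else paramPoint N 0 i
  have hu' : ∀ l, SuppBelow N l → eval u' l = (-eval u v)⁻¹ * eval u l := fun l hl => by
    rw [← eval_smul]
    exact eval_congr hl fun i hi => if_pos hi
  have huN : ∀ k, N ≤ k → u' k = paramPoint N 0 k := fun k hk => if_neg (by omega)
  have := (elim_paramPoint_iff N (refuteSystem N v rest) 0).2 ⟨u', huN, ?_⟩ c hc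
  · linarith
  · intro c hc
    rcases List.mem_cons.1 hc with rfl | hc
    · rw [eval_cons, eval_scale, huN N le_rfl, paramPoint_self, hu' v hv]
      have : (-eval u v)⁻¹ * eval u v = -1 := by
        have : eval u v ≠ 0 := hneg.ne
        field_simp
      rw [this]
      norm_num
    · rw [hu' c (hrest c hc)]
      exact mul_nonneg hr (hu c hc)

/-- One step of the removal of redundant forms, on a pair (forms to be kept, forms to be tested). -/
noncomputable def reduceStep (N : ℕ) (st : List LinForm × List LinForm) :
    List LinForm × List LinForm :=
  List.rec (motive := fun _ => List LinForm × List LinForm) st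
    (fun v rest _ =>
      if 0 < violation N (elim N (refuteSystem N v (st.1 ++ rest))) then (st.1, rest)
      else (v :: st.1, rest)) st.2

/-- Successive removal of all forms whose nonnegativity is implied by that of the remaining ones. -/
noncomputable def reduce (N : ℕ) (ls : List LinForm) : List LinForm :=
  (Nat.rec (motive := fun _ => List LinForm × List LinForm) ([], ls)
    (fun _ st => reduceStep N st) ls.length).1

/-- Every form in `kept` is negative at some point where all other forms of `kept` and all of `todo`
are nonnegative. -/
def IrredundantWith (kept todo : List LinForm) : Prop :=
  ∀ p v q, kept = p ++ v :: q →
    ∃ u, eval u v < 0 ∧ ∀ w, w ∈ p ∨ w ∈ q ∨ w ∈ todo → 0 ≤ eval u w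

theorem reduce_spec {N : ℕ} {ls : List LinForm} (hls : ∀ l ∈ ls, SuppBelow N l) :
    (∀ l ∈ reduce N ls, SuppBelow N l) ∧ IrredundantWith (reduce N ls) [] ∧
      ∀ u, (∀ l ∈ reduce N ls, 0 ≤ eval u l) ↔ ∀ l ∈ ls, 0 ≤ eval u l := by
  let st : ℕ → List LinForm × List LinForm := fun n =>
    Nat.rec (motive := fun _ => List LinForm × List LinForm) ([], ls)
      (fun _ st => reduceStep N st) n
  have key : ∀ n, (st n).2 = ls.drop n ∧ (∀ l ∈ (st n).1, SuppBelow N l) ∧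
      IrredundantWith (st n).1 (st n).2 ∧
      ∀ u, ((∀ l ∈ (st n).1, 0 ≤ eval u l) ∧ ∀ l ∈ (st n).2, 0 ≤ eval u l) ↔
        ∀ l ∈ ls, 0 ≤ eval u l := by
    intro n
    induction n with
    | zero =>
      refine ⟨rfl, by simp [st], fun p v q h => ?_, fun u => by simp [st]⟩
      simp [st] at h
    | succ n ih =>
      obtain ⟨hdrop, hsupp, hirr, hiff⟩ := ih
      have hst : st (n + 1) = reduceStep N (st n) := rfl
      generalize st n = s at *
      obtain ⟨kept, todo⟩ := s
      simp only at hdrop hsupp hirr hiff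
      cases todo with
      | nil =>
        have : st (n + 1) = (kept, []) := hst
        rw [this]
        refine ⟨?_, hsupp, hirr, hiff⟩
        rw [← List.tail_drop, ← hdrop, List.tail_nil]
      | cons v rest =>
        have hdrop' : rest = ls.drop (n + 1) := by rw [← List.tail_drop, ← hdrop, List.tail_cons]
        have hvrest : ∀ w ∈ v :: rest, SuppBelow N w := fun w hw =>
          hls w (List.mem_of_mem_drop (hdrop ▸ hw))
        have hst' : st (n + 1) =
            if 0 < violation N (elim N (refuteSystem N v (kept ++ rest))) then (kept, rest)
            else (v :: kept, rest) := hst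
        by_cases hviol : 0 < violation N (elim N (refuteSystem N v (kept ++ rest)))
        · rw [hst', if_pos hviol]
          refine ⟨hdrop', hsupp, fun p v' q h => ?_, fun u => ?_⟩
          · obtain ⟨u, hu, hw⟩ := hirr p v' q h
            exact ⟨u, hu, fun w h => hw w
              (h.imp_right (Or.imp_right (List.mem_cons_of_mem _)))⟩
          · rw [← hiff u]
            refine and_congr_right fun hk => ?_
            rw [List.forall_mem_cons]
            refine ⟨fun hr => ⟨?_, hr⟩, And.right⟩
            refine nonneg_of_violation (hvrest v List.mem_cons_self) ?_ hviol
              (List.forall_mem_append.2 ⟨hk, hr⟩)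
            exact List.forall_mem_append.2
              ⟨hsupp, fun w hw => hvrest w (List.mem_cons_of_mem _ hw)⟩
        · rw [hst', if_neg hviol]
          refine ⟨hdrop', ?_, fun p v' q h => ?_, fun u => ?_⟩
          · exact List.forall_mem_cons.2 ⟨hvrest v List.mem_cons_self, hsupp⟩
          · rcases List.cons_eq_append_iff.1 h with ⟨rfl, h'⟩ | ⟨p', rfl, h'⟩
            · obtain ⟨rfl, rfl⟩ := List.cons.inj h'
              obtain ⟨u, hu, hw⟩ := exists_of_not_violation hviol
              refine ⟨u, hu, fun w h => hw w (List.mem_append.2 ?_)⟩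
              simpa using h
            · obtain ⟨u, hu, hw⟩ := hirr p' v' q h'
              refine ⟨u, hu, fun w h => hw w ?_⟩
              simp only [List.mem_cons] at h ⊢
              tauto
          · rw [← hiff u, List.forall_mem_cons, List.forall_mem_cons]
            tauto
  obtain ⟨hdrop, hsupp, hirr, hiff⟩ := key ls.length
  have h2 : (st ls.length).2 = [] := by rw [hdrop, List.drop_length]
  rw [h2] at hirr
  simp only [h2, List.not_mem_nil, false_imp_iff, implies_true, and_true] at hiff
  exact ⟨hsupp, hirr, hiff⟩

theorem IrredundantWith.exists_getElem {ls : List LinForm} (h : IrredundantWith ls [])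
    (i : Fin ls.length) :
    ∃ u, eval u ls[i] < 0 ∧ ∀ j : Fin ls.length, j ≠ i → 0 ≤ eval u ls[j] := by
  obtain ⟨u, hu, hw⟩ := h (ls.take i) ls[i] (ls.drop (i + 1)) (by
    simp)
  refine ⟨u, hu, fun j hj => hw _ ?_⟩
  rcases lt_or_gt_of_ne (Fin.val_ne_of_ne hj) with h | h
  · exact Or.inl (List.mem_take_iff_getElem.2 ⟨j, by simp [h], rfl⟩)
  · refine Or.inr (Or.inl (List.mem_drop_iff_getElem.2 ⟨j - (i + 1), by omega, ?_⟩))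
    simp only [Fin.getElem_fin]
    congr 1
    omega

end LinForm

namespace RealComputable

variable {α : Type}

open LinForm

theorem violation_of {N : α → ℕ} {cs : α → List LinForm} (hN : RealComputable N)
    (hcs : RealComputable cs) : RealComputable (fun a => violation (N a) (cs a)) :=
  foldr_of const_zero
    (branch (neg_of (coef_of (comp_fst hN) (fst_of snd))) one (snd_of snd)) hcs

theorem refuteSystem_of {N : α → ℕ} {v : α → LinForm} {rest : α → List LinForm}
    (hN : RealComputable N) (hv : RealComputable v) (hrest : RealComputable rest) :
    RealComputable (fun a => refuteSystem (N a) (v a) (rest a)) :=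
  cons_of (cons_of (pair (neg_of one) hN) (scale_of (neg_of one) hv)) hrest

theorem reduceStep_of {N : α → ℕ} {st : α → List LinForm × List LinForm}
    (hN : RealComputable N) (hst : RealComputable st) :
    RealComputable (fun a => reduceStep (N a) (st a)) :=
  listRec_of hst
    (branch (violation_of (comp_fst hN) (elim_of (comp_fst hN)
      (refuteSystem_of (comp_fst hN) (fst_of snd)
        (append_of (comp_fst (fst_of hst)) (fst_of (snd_of snd))))))
      (pair (comp_fst (fst_of hst)) (fst_of (snd_of snd)))
      (pair (cons_of (fst_of snd) (comp_fst (fst_of hst))) (fst_of (snd_of snd))))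
    (snd_of hst)

theorem reduce_of {N : α → ℕ} {ls : α → List LinForm} (hN : RealComputable N)
    (hls : RealComputable ls) : RealComputable (fun a => reduce (N a) (ls a)) :=
  fst_of (natRec_of (pair nil hls) (reduceStep_of (comp_fst hN) (snd_of snd)) (length_of hls))

end RealComputable

/-! ### A computable margin for the faces of a cone -/

namespace LinForm

/-- The system `1 ≤ ∑ l ∈ ls, l`, `-ε ≤ l` for `l ∈ ls`, and `l ≤ ε` for `l ∈ I`, with `1` and `ε`
carried by `u_N` and `u_{N+1}`. -/
noncomputable def marginSystem (N : ℕ) (ls I : List LinForm) : List LinForm :=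
  ((-1, N) :: ls.flatten) ::
    (ls.map (fun l => (1, N + 1) :: l) ++ I.map fun l => (1, N + 1) :: scale (-1) l)

/-- If `α + β * ε` with `α = coef N c < 0` and `β = coef (N + 1) c`, then a positive number such that
`α + β * ε < 0` for all smaller `ε ≥ 0`. -/
noncomputable def gap (N : ℕ) (c : LinForm) : ℝ :=
  if 0 < -coef N c then -coef N c / (1 + coef (N + 1) c * coef (N + 1) c) else 1

/-- The minimum of `1` and the members of a list. -/
noncomputable def minOne (xs : List ℝ) : ℝ := xs.foldr (fun x r => if 0 < r - x then x else r) 1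

/-- A number `δ > 0` such that, for every subsystem `I` of `ls`, if the margin system of `I` is
feasible with `ε = δ`, then it is feasible with `ε = 0`. -/
noncomputable def margin (N : ℕ) (ls : List LinForm) : ℝ :=
  minOne (ls.sublists'.flatMap fun I => (elim N (marginSystem N ls I)).map (gap N))

theorem gap_pos (N : ℕ) (c : LinForm) : 0 < gap N c := by
  unfold gap
  split_ifs with h
  · exact div_pos h (by nlinarith [mul_self_nonneg (coef (N + 1) c)])
  · exact one_pos

theorem add_mul_neg_of_le_gap {N : ℕ} {c : LinForm} (hc : coef N c < 0) {ε : ℝ} (h0 : 0 ≤ ε)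
    (hε : ε ≤ gap N c) : coef N c + ε * coef (N + 1) c < 0 := by
  unfold gap at hε
  rw [if_pos (by linarith)] at hε
  set β := coef (N + 1) c
  have hpos : 0 < 1 + β * β := by nlinarith [mul_self_nonneg β]
  rw [le_div_iff₀ hpos] at hε
  rcases h0.eq_or_lt with rfl | h0
  · simpa using hc
  · have : β < 1 + β * β := by nlinarith [sq_nonneg (β - 1), sq_nonneg β]
    have := mul_lt_mul_of_pos_left this h0
    linarith

theorem minOne_le_one (xs : List ℝ) : minOne xs ≤ 1 := by
  induction xs with
  | nil => exact le_rfl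
  | cons x xs ih =>
    have : minOne (x :: xs) = if 0 < minOne xs - x then x else minOne xs := rfl
    rw [this]
    split_ifs with h <;> linarith

theorem minOne_le {xs : List ℝ} {x : ℝ} (hx : x ∈ xs) : minOne xs ≤ x := by
  induction xs with
  | nil => simp at hx
  | cons y xs ih =>
    have : minOne (y :: xs) = if 0 < minOne xs - y then y else minOne xs := rfl
    rw [this]
    rcases List.mem_cons.1 hx with rfl | hx
    · split_ifs with h <;> linarith
    · have := ih hx
      split_ifs with h <;> linarith

theorem minOne_pos {xs : List ℝ} (h : ∀ x ∈ xs, 0 < x) : 0 < minOne xs := by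
  induction xs with
  | nil => exact one_pos
  | cons x xs ih =>
    have : minOne (x :: xs) = if 0 < minOne xs - x then x else minOne xs := rfl
    rw [this]
    split_ifs
    · exact h x List.mem_cons_self
    · exact ih fun y hy => h y (List.mem_cons_of_mem _ hy)

theorem margin_pos (N : ℕ) (ls : List LinForm) : 0 < margin N ls := by
  refine minOne_pos fun x hx => ?_
  obtain ⟨I, -, hx⟩ := List.mem_flatMap.1 hx
  obtain ⟨c, -, rfl⟩ := List.mem_map.1 hx
  exact gap_pos N c

/-- If all forms are at least `-margin` at a point, then those which are at most `margin` there
vanish simultaneously at some point of the cone. -/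
theorem exists_of_margin {N : ℕ} {ls : List LinForm} (hls : ∀ l ∈ ls, SuppBelow N l) {u : ℕ → ℝ}
    (hsum : 1 ≤ eval u ls.flatten) (hu : ∀ l ∈ ls, -margin N ls ≤ eval u l) :
    ∃ v, 1 ≤ eval v ls.flatten ∧ (∀ l ∈ ls, 0 ≤ eval v l) ∧
      ∀ l ∈ ls, eval u l ≤ margin N ls → eval v l = 0 := by
  set I := ls.filter fun l => eval u l ≤ margin N ls with hI
  set ε := margin N ls with hε
  have hIsub : I ∈ ls.sublists' := List.mem_sublists'.2 List.filter_sublist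
  have hImem : ∀ l ∈ I, l ∈ ls ∧ eval u l ≤ ε := fun l hl => by simpa [hI] using hl
  have hflat : SuppBelow N ls.flatten := fun t ht => by
    obtain ⟨l, hl, ht⟩ := List.mem_flatten.1 ht
    exact hls l hl t ht
  let u' : ℕ → ℝ := fun i => if i < N then u i else paramPoint N ε i
  have hu' : ∀ l, SuppBelow N l → eval u' l = eval u l := fun l hl =>
    eval_congr hl fun i hi => if_pos hi
  have huN : ∀ k, N ≤ k → u' k = paramPoint N ε k := fun k hk => if_neg (by omega)
  have h1 := (elim_paramPoint_iff N (marginSystem N ls I) ε).2 ⟨u', huN, by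
    intro c hc
    rcases List.mem_cons.1 hc with rfl | hc
    · rw [eval_cons, huN N le_rfl, paramPoint_self, hu' _ hflat]
      linarith
    rcases List.mem_append.1 hc with hc | hc
    · obtain ⟨l, hl, rfl⟩ := List.mem_map.1 hc
      rw [eval_cons, huN _ (Nat.le_succ N), paramPoint_succ, hu' l (hls l hl)]
      linarith [hu l hl]
    · obtain ⟨l, hl, rfl⟩ := List.mem_map.1 hc
      rw [eval_cons, eval_scale, huN _ (Nat.le_succ N), paramPoint_succ,
        hu' l (hls l (hImem l hl).1)]
      linarith [(hImem l hl).2]⟩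
  have h0 : ∀ c ∈ elim N (marginSystem N ls I), 0 ≤ coef N c + 0 * coef (N + 1) c := by
    intro c hc
    rw [zero_mul, add_zero]
    by_contra hneg
    push Not at hneg
    refine (add_mul_neg_of_le_gap hneg (margin_pos N ls).le ?_).not_ge (h1 c hc)
    exact minOne_le (List.mem_flatMap.2 ⟨I, hIsub, List.mem_map_of_mem hc⟩)
  obtain ⟨v, hvN, hv⟩ := (elim_paramPoint_iff N (marginSystem N ls I) 0).1 h0
  have hnonneg : ∀ l ∈ ls, 0 ≤ eval v l := fun l hl => by
    have := hv _ (List.mem_cons_of_mem _ (List.mem_append_left _ (List.mem_map_of_mem hl)))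
    rw [eval_cons, hvN _ (Nat.le_succ N), paramPoint_succ] at this
    linarith
  refine ⟨v, ?_, hnonneg, fun l hl hle => le_antisymm ?_ (hnonneg l hl)⟩
  · have := hv _ List.mem_cons_self
    rw [eval_cons, hvN _ le_rfl, paramPoint_self] at this
    linarith
  · have hlI : l ∈ I := by simp [hI, hl, hle]
    have := hv _ (List.mem_cons_of_mem _ (List.mem_append_right _ (List.mem_map_of_mem hlI)))
    rw [eval_cons, eval_scale, hvN _ (Nat.le_succ N), paramPoint_succ] at this
    linarith

end LinForm

/-! ### Signs from elementary symmetric functions -/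

namespace List

/-- The elementary symmetric function of degree `xs.length - j` (zero if `j > xs.length`). -/
noncomputable def coSym (j : ℕ) (xs : List ℝ) : ℝ :=
  (xs.sublists'.map fun I => if I.length + j = xs.length then I.prod else 0).sum

theorem sum_map_add_fun {α : Type} (l : List α) (f g : α → ℝ) :
    (l.map fun a => f a + g a).sum = (l.map f).sum + (l.map g).sum := by
  induction l with
  | nil => simp
  | cons a l ih => simp only [map_cons, sum_cons, ih]; ring

theorem sum_map_finsetSum {α ι : Type} (l : List α) (s : Finset ι) (f : ι → α → ℝ) :
    (l.map fun a => ∑ i ∈ s, f i a).sum = ∑ i ∈ s, (l.map (f i)).sum := by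
  induction l with
  | nil => simp
  | cons a l ih => simp only [map_cons, sum_cons, ih, Finset.sum_add_distrib]

theorem sum_map_mul_const {α : Type} (l : List α) (f : α → ℝ) (r : ℝ) :
    (l.map fun a => f a * r).sum = (l.map f).sum * r := by
  induction l with
  | nil => simp
  | cons a l ih => simp only [map_cons, sum_cons, ih]; ring

theorem length_le_of_mem_sublists' {xs I : List ℝ} (h : I ∈ xs.sublists') :
    I.length ≤ xs.length := (mem_sublists'.1 h).length_le

theorem prod_map_add_eq_sum (s : ℝ) (xs : List ℝ) :
    (xs.map fun x => s + x).prod =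
      (xs.sublists'.map fun I => I.prod * s ^ (xs.length - I.length)).sum := by
  induction xs with
  | nil => simp
  | cons x xs ih =>
    rw [map_cons, prod_cons, ih, sublists'_cons, map_append, sum_append, add_mul, map_map]
    congr 1
    · rw [mul_comm, ← sum_map_mul_const]
      congr 1
      refine map_congr_left fun I hI => ?_
      have := length_le_of_mem_sublists' hI
      rw [length_cons, Nat.succ_sub this, pow_succ, mul_assoc]
    · rw [mul_comm, ← sum_map_mul_const]
      congr 1
      refine map_congr_left fun I hI => ?_
      simp only [Function.comp_apply, length_cons, prod_cons, Nat.add_sub_add_right]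
      ring

theorem le_prod_of_mem_Icc {η : ℝ} (h0 : 0 ≤ η) (h1 : η ≤ 1) (I : List ℝ)
    (hI : ∀ x ∈ I, -η ≤ x ∧ x ≤ 2) :
    |I.prod| ≤ 2 ^ I.length ∧ -(2 ^ I.length * η) ≤ I.prod := by
  induction I with
  | nil => exact ⟨by simp, by simp only [length_nil, pow_zero, prod_nil]; linarith⟩
  | cons x I ih =>
    obtain ⟨ha, hb⟩ := ih fun y hy => hI y (mem_cons_of_mem _ hy)
    obtain ⟨hx1, hx2⟩ := hI x mem_cons_self
    rw [prod_cons, length_cons, pow_succ]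
    have hp : (0 : ℝ) < 2 ^ I.length := by positivity
    constructor
    · rw [abs_mul, mul_comm]
      exact mul_le_mul ha (abs_le.2 ⟨by linarith, hx2⟩) (abs_nonneg _) hp.le
    · rcases le_total 0 x with hx | hx
      · have h2 := mul_le_mul_of_nonneg_left hb hx
        have h3 := mul_le_mul_of_nonneg_right hx2 (mul_nonneg hp.le h0)
        linarith
      · have h2 := mul_le_mul_of_nonpos_left (abs_le.1 ha).2 hx
        have h3 := mul_le_mul_of_nonneg_right hx1 hp.le
        nlinarith [mul_nonneg hp.le h0]

theorem pow_length_le_prod {δ : ℝ} (hδ : 0 ≤ δ) (I : List ℝ) (hI : ∀ x ∈ I, δ ≤ x) :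
    δ ^ I.length ≤ I.prod := by
  induction I with
  | nil => simp
  | cons x I ih =>
    rw [prod_cons, length_cons, pow_succ, mul_comm]
    have h := ih fun y hy => hI y (mem_cons_of_mem _ hy)
    have hx := hI x mem_cons_self
    exact mul_le_mul hx h (by positivity) (hδ.trans hx)

theorem le_sum_map_of_mem {α : Type} (l : List α) (f : α → ℝ) {r s : ℝ} (hr : 0 ≤ r)
    (hf : ∀ a ∈ l, -r ≤ f a) {a₀ : α} (ha₀ : a₀ ∈ l) (hs : s ≤ f a₀) :
    s - l.length * r ≤ (l.map f).sum := by
  have hall : ∀ l : List α, (∀ a ∈ l, -r ≤ f a) → -(l.length * r) ≤ (l.map f).sum := by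
    intro l hl
    induction l with
    | nil => simp
    | cons a l ih =>
      have h1 := ih fun b hb => hl b (mem_cons_of_mem _ hb)
      have h2 := hl a mem_cons_self
      rw [map_cons, sum_cons, length_cons]
      push_cast
      linarith
  induction l with
  | nil => simp at ha₀
  | cons a l ih =>
    rw [map_cons, sum_cons, length_cons]
    push_cast
    have hl : ∀ b ∈ l, -r ≤ f b := fun b hb => hf b (mem_cons_of_mem _ hb)
    rcases mem_cons.1 ha₀ with rfl | h
    · linarith [hall l hl]
    · linarith [ih hl h, hf a mem_cons_self]

/-- Suppose that all but `d` of the numbers exceed `δ`, and that none is below `-η`, for an `η` which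
is small compared to `δ`.  Then nonnegativity of the `d` elementary symmetric functions of highest
degree implies that none is negative: these are the lowest coefficients of `∏ (s + x)`, whose next
coefficient is bounded below, so that this polynomial has no small positive root `s = -x`. -/
theorem nonneg_of_coSym_nonneg {d : ℕ} {η δ : ℝ} {xs : List ℝ} (hη : 0 ≤ η) (hδ : 0 < δ)
    (hδ1 : δ ≤ 1) (hηδ : 4 ^ xs.length * η < δ ^ xs.length) (hxs : ∀ x ∈ xs, -η ≤ x ∧ x ≤ 2)
    (hcount : xs.countP (fun x => x ≤ δ) ≤ d) (hsym : ∀ j < d, 0 ≤ coSym j xs) :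
    ∀ x ∈ xs, 0 ≤ x := by
  wlog hd : d ≤ xs.length generalizing d
  · push Not at hd
    exact this countP_le_length (fun j hj => hsym j (hj.trans hd)) le_rfl
  set m := xs.length with hm
  by_contra hcon
  push Not at hcon
  obtain ⟨x, hx, hx0⟩ := hcon
  set s := -x with hs
  have hs0 : 0 < s := by linarith
  have hη1 : η ≤ 1 := by
    have h1 : δ ^ m ≤ 1 := pow_le_one₀ hδ.le hδ1
    have h2 : (1 : ℝ) ≤ 4 ^ m := one_le_pow₀ (by norm_num)
    nlinarith
  have hsη : s ≤ η := by linarith [(hxs x hx).1]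
  have hs1 : s ≤ 1 := hsη.trans hη1
  have hzero : (xs.sublists'.map fun I => I.prod * s ^ (m - I.length)).sum = 0 := by
    rw [← prod_map_add_eq_sum, prod_eq_zero_iff, mem_map]
    exact ⟨x, hx, by linarith⟩
  have hsplit : (xs.sublists'.map fun I => I.prod * s ^ (m - I.length)).sum =
      ∑ j ∈ Finset.range d, coSym j xs * s ^ j +
        (xs.sublists'.map fun I =>
          if I.length + d ≤ m then I.prod * s ^ (m - I.length) else 0).sum := by
    simp only [coSym, ← sum_map_mul_const]
    rw [← sum_map_finsetSum, ← sum_map_add_fun]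
    congr 1
    refine map_congr_left fun I hI => ?_
    have hIm : I.length ≤ m := length_le_of_mem_sublists' hI
    by_cases h : I.length + d ≤ m
    · rw [if_pos h, Finset.sum_eq_zero, zero_add]
      intro j hj
      rw [if_neg (by have := Finset.mem_range.1 hj; omega), zero_mul]
    · rw [if_neg h, add_zero, Finset.sum_eq_single (m - I.length)]
      · rw [if_pos (by omega)]
      · intro j _ hj
        rw [if_neg (by omega), zero_mul]
      · intro h'
        rw [Finset.mem_range] at h'
        omega
  -- a sublist of `m - d` large numbers, whose product dominates the remaining terms
  have hlarge : m - d ≤ (xs.filter fun x => ¬ x ≤ δ).length := by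
    have := length_eq_countP_add_countP (fun x : ℝ => decide (x ≤ δ)) (l := xs)
    rw [← countP_eq_length_filter]
    simp only [Bool.not_eq_true, decide_eq_false_iff_not] at this
    omega
  set I₀ := (xs.filter fun x => ¬ x ≤ δ).take (m - d) with hI₀
  have hI₀len : I₀.length = m - d := by
    rw [hI₀, length_take]
    omega
  have hI₀mem : I₀ ∈ xs.sublists' :=
    mem_sublists'.2 ((take_sublist _ _).trans filter_sublist)
  have hI₀prod : δ ^ m ≤ I₀.prod := by
    refine le_trans ?_ (pow_length_le_prod hδ.le I₀ fun y hy => ?_)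
    · exact pow_le_pow_of_le_one hδ.le hδ1 (by omega)
    · have := (mem_filter.1 (mem_of_mem_take hy)).2
      simp only [not_le, decide_eq_true_eq] at this
      exact this.le
  have hlow := le_sum_map_of_mem xs.sublists'
    (fun I => if I.length + d ≤ m then I.prod * s ^ (m - I.length) else 0)
    (r := 2 ^ m * η * s ^ d) (s := δ ^ m * s ^ d) (by positivity) (fun I hI => ?_) hI₀mem ?_
  · have hsum : 0 ≤ ∑ j ∈ Finset.range d, coSym j xs * s ^ j :=
      Finset.sum_nonneg fun j hj => mul_nonneg (hsym j (Finset.mem_range.1 hj)) (by positivity)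
    have hpos : 0 < (δ ^ m - 4 ^ m * η) * s ^ d := mul_pos (by linarith) (by positivity)
    rw [length_sublists', ← hm] at hlow
    push_cast at hlow
    have h4 : (2 : ℝ) ^ m * (2 ^ m * η * s ^ d) = 4 ^ m * η * s ^ d := by
      rw [show (4 : ℝ) = 2 * 2 by norm_num, mul_pow]
      ring
    rw [h4] at hlow
    linarith
  · have hIm : I.length ≤ m := length_le_of_mem_sublists' hI
    have hneg : -(2 ^ m * η * s ^ d) ≤ 0 := by
      have : 0 ≤ 2 ^ m * η * s ^ d := by positivity
      linarith
    split_ifs with h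
    · have hprod := (le_prod_of_mem_Icc hη hη1 I
        fun y hy => hxs y ((mem_sublists'.1 hI).subset hy)).2
      have h2 : (2 : ℝ) ^ I.length ≤ 2 ^ m := pow_le_pow_right₀ (by norm_num) hIm
      have hp : -(2 ^ m * η) ≤ I.prod := by nlinarith
      have hsd : s ^ (m - I.length) ≤ s ^ d := pow_le_pow_of_le_one hs0.le hs1 (by omega)
      have hsp : 0 < s ^ (m - I.length) := by positivity
      rcases le_total 0 I.prod with h' | h'
      · exact hneg.trans (by positivity)
      · have ha := mul_le_mul_of_nonpos_left hsd h'
        have hb := mul_le_mul_of_nonneg_right hp (by positivity : 0 ≤ s ^ d)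
        linarith
    · exact hneg
  · rw [if_pos (by omega), hI₀len, Nat.sub_sub_self hd]
    exact mul_le_mul_of_nonneg_right hI₀prod (by positivity)

end List

namespace RealComputable

variable {α : Type}

open LinForm

theorem marginSystem_of {N : α → ℕ} {ls I : α → List LinForm}
    (hN : RealComputable N) (hls : RealComputable ls) (hI : RealComputable I) :
    RealComputable (fun a => marginSystem (N a) (ls a) (I a)) :=
  cons_of (cons_of (pair (neg_of one) hN) (flatten_of hls))
    (append_of (map_of (cons_of (pair one (succ_of (comp_fst hN))) snd) hls)
      (map_of (cons_of (pair one (succ_of (comp_fst hN))) (scale_of (neg_of one) snd)) hI))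

theorem gap_of {N : α → ℕ} {c : α → LinForm} (hN : RealComputable N) (hc : RealComputable c) :
    RealComputable (fun a => gap (N a) (c a)) :=
  branch (neg_of (coef_of hN hc))
    (div_of (neg_of (coef_of hN hc))
      (add_of one (mul_of (coef_of (succ_of hN) hc) (coef_of (succ_of hN) hc)))) one

theorem margin_of {N : α → ℕ} {ls : α → List LinForm} (hN : RealComputable N)
    (hls : RealComputable ls) : RealComputable (fun a => margin (N a) (ls a)) :=
  foldr_of one (branch (sub_of (snd_of snd) (fst_of snd)) (fst_of snd) (snd_of snd))
    (flatMap_of (map_of (gap_of (comp_fst (comp_fst hN)) snd)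
      (elim_of (comp_fst hN) (marginSystem_of (comp_fst hN) (comp_fst hls) snd)))
      (sublists'_of hls))

end RealComputable

/-! ### Polynomials as lists of words -/

/-- A polynomial in `u₀, u₁, …` as a list of terms (coefficient, word); the word `[i₁, …, i_n]` stands
for the monomial `u_{i₁} ⋯ u_{i_n}`. -/
abbrev WordPoly := List (ℝ × List ℕ)

namespace WordPoly

/-- The value of a polynomial at `u`. -/
def eval (u : ℕ → ℝ) (p : WordPoly) : ℝ := (p.map fun t => t.1 * (t.2.map u).prod).sum

/-- The product of polynomials. -/
def mul (p q : WordPoly) : WordPoly := p.flatMap fun t => q.map fun r => (t.1 * r.1, t.2 ++ r.2)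

/-- A linear form as a polynomial. -/
def ofForm (l : LinForm) : WordPoly := l.map fun t => (t.1, [t.2])

/-- The power of a polynomial. -/
def pow (p : WordPoly) (n : ℕ) : WordPoly :=
  Nat.rec (motive := fun _ => WordPoly) [(1, [])] (fun _ r => mul r p) n

/-- The elementary symmetric polynomial of degree `ls.length - j` of linear forms. -/
def coSym (j : ℕ) (ls : List LinForm) : WordPoly :=
  ls.sublists'.flatMap fun I =>
    if I.length + j = ls.length then I.foldr (fun l r => mul (ofForm l) r) [(1, [])] else []

/-- With `σ = ∑ l ∈ ls, l` and `m = ls.length`, the polynomial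
`m * σ ^ (2 * k) - ∑ l ∈ ls, (2 * l - σ) ^ (2 * k)`. -/
noncomputable def shell (ls : List LinForm) (k : ℕ) : WordPoly :=
  mul [((ls.length : ℝ), [])] (pow (ofForm ls.flatten) (k + k)) ++
    ls.flatMap fun l => mul [(-1, [])]
      (pow (ofForm (LinForm.scale 2 l ++ LinForm.scale (-1) ls.flatten)) (k + k))

theorem eval_cons (u : ℕ → ℝ) (t : ℝ × List ℕ) (p : WordPoly) :
    eval u (t :: p) = t.1 * (t.2.map u).prod + eval u p := by simp [eval]

theorem eval_append (u : ℕ → ℝ) (p q : WordPoly) : eval u (p ++ q) = eval u p + eval u q := by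
  simp [eval]

theorem eval_const (u : ℕ → ℝ) (r : ℝ) : eval u [(r, [])] = r := by simp [eval]

theorem eval_flatMap {α : Type} (u : ℕ → ℝ) (l : List α) (f : α → WordPoly) :
    eval u (l.flatMap f) = (l.map fun a => eval u (f a)).sum := by
  induction l with
  | nil => rfl
  | cons a l ih => rw [List.flatMap_cons, eval_append, ih, List.map_cons, List.sum_cons]

theorem eval_mul (u : ℕ → ℝ) (p q : WordPoly) : eval u (mul p q) = eval u p * eval u q := by
  unfold mul
  rw [eval_flatMap]
  unfold eval
  rw [← List.sum_map_mul_const]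
  congr 1
  refine List.map_congr_left fun t _ => ?_
  rw [mul_comm, ← List.sum_map_mul_const, List.map_map]
  congr 1
  refine List.map_congr_left fun r _ => ?_
  simp only [Function.comp_apply, List.map_append, List.prod_append]
  ring

theorem eval_ofForm (u : ℕ → ℝ) (l : LinForm) : eval u (ofForm l) = LinForm.eval u l := by
  simp [eval, ofForm, LinForm.eval, Function.comp_def]

theorem eval_pow (u : ℕ → ℝ) (p : WordPoly) (n : ℕ) : eval u (pow p n) = eval u p ^ n := by
  induction n with
  | zero => simp [pow, eval]
  | succ n ih =>
    have : pow p (n + 1) = mul (pow p n) p := rfl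
    rw [this, eval_mul, ih, pow_succ]

theorem eval_coSym (u : ℕ → ℝ) (j : ℕ) (ls : List LinForm) :
    eval u (coSym j ls) = List.coSym j (ls.map (LinForm.eval u)) := by
  have hprod : ∀ I : List LinForm,
      eval u (I.foldr (fun l r => mul (ofForm l) r) [(1, [])]) =
        (I.map (LinForm.eval u)).prod := by
    intro I
    induction I with
    | nil => simp [eval]
    | cons l I ih => rw [List.foldr_cons, eval_mul, ih, eval_ofForm, List.map_cons, List.prod_cons]
  rw [coSym, eval_flatMap, List.coSym, List.sublists'_map, List.map_map]
  congr 1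
  refine List.map_congr_left fun I _ => ?_
  simp only [Function.comp_apply, List.length_map]
  split_ifs
  · exact hprod I
  · rfl

theorem eval_shell (u : ℕ → ℝ) (ls : List LinForm) (k : ℕ) :
    eval u (shell ls k) = ls.length * LinForm.eval u ls.flatten ^ (k + k) -
      (ls.map fun l => (2 * LinForm.eval u l - LinForm.eval u ls.flatten) ^ (k + k)).sum := by
  rw [shell, eval_append, eval_mul, eval_const, eval_pow, eval_ofForm, eval_flatMap, sub_eq_add_neg]
  congr 1
  rw [← mul_neg_one (List.sum (List.map _ _)), ← List.sum_map_mul_const]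
  congr 1
  refine List.map_congr_left fun l _ => ?_
  rw [eval_mul, eval_const, eval_pow, eval_ofForm, LinForm.eval_append, LinForm.eval_scale,
    LinForm.eval_scale, neg_one_mul, neg_one_mul, mul_neg_one, ← sub_eq_add_neg]

end WordPoly

/-! ### The construction -/

namespace StronglySimple

open LinForm

/-- A positive number which is small compared to the margin of the system. -/
noncomputable def tolerance (N : ℕ) (ls : List LinForm) : ℝ :=
  (margin N ls / ((4 : ℕ) : ℝ)) ^ (ls.length + 1)

theorem tolerance_pos (N : ℕ) (ls : List LinForm) : 0 < tolerance N ls :=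
  pow_pos (div_pos (margin_pos N ls) (by norm_num)) _

theorem exists_shellExponent (N : ℕ) (ls : List LinForm) :
    ∃ n : ℕ, 0 < n * tolerance N ls - ls.length := by
  obtain ⟨n, hn⟩ := exists_nat_gt (ls.length / tolerance N ls)
  refine ⟨n, ?_⟩
  rw [div_lt_iff₀ (tolerance_pos N ls)] at hn
  linarith

/-- An exponent for which the polynomial `WordPoly.shell` bounds the forms from below up to the
tolerance. -/
noncomputable def shellExponent (N : ℕ) (ls : List LinForm) : ℕ :=
  Nat.find (exists_shellExponent N ls)

theorem shellExponent_spec (N : ℕ) (ls : List LinForm) :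
    (ls.length : ℝ) < shellExponent N ls * tolerance N ls :=
  sub_pos.1 (Nat.find_spec (exists_shellExponent N ls))

/-- The form `-∑ i, a_i * u_{i+1}`. -/
def negForm (a : List ℝ) : LinForm :=
  a.foldr (fun x r => (-x, 1) :: r.map fun t => (t.1, t.2 + 1)) []

/-- The homogenized constraints of a polyhedron: `0 ≤ u₀` and `0 ≤ b * u₀ - ∑ i, a_i * u_{i+1}`. -/
def coneForms (H : List (List ℝ × ℝ)) : List LinForm :=
  [(1, 0)] :: H.map fun h => (h.2, 0) :: negForm h.1

/-- The dehomogenization `u₀ = 1`, `u_{i+1} = x_i` of a polynomial, as a list of coefficients and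
exponent vectors. -/
def toExponents (d : ℕ) (p : WordPoly) : List (ℝ × List ℕ) :=
  p.map fun t => (t.1, (List.range d).map fun i => t.2.count (i + 1))

/-- The `d` elementary symmetric polynomials of highest degree of the given forms and, if `2 ≤ d`,
their sum and the polynomial `WordPoly.shell`. -/
noncomputable def describe (d : ℕ) (ls : List LinForm) : List WordPoly :=
  (List.range d).map (fun j => WordPoly.coSym j ls) ++
    if 0 < (d : ℝ) - 1 then
      [WordPoly.ofForm ls.flatten, WordPoly.shell ls (shellExponent (d + 1) ls)]
    else []

/-- The construction of the polynomials from an H-representation. -/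
noncomputable def construct (inp : ℕ × List (List ℝ × ℝ)) : List (List (ℝ × List ℕ)) :=
  (describe inp.1 (reduce (inp.1 + 1) (coneForms inp.2))).map (toExponents inp.1)

end StronglySimple

namespace RealComputable

variable {α : Type}

theorem wordMul_of {p q : α → WordPoly} (hp : RealComputable p) (hq : RealComputable q) :
    RealComputable (fun a => WordPoly.mul (p a) (q a)) :=
  flatMap_of (map_of (pair (mul_of (fst_of (snd_of fst)) (fst_of snd))
    (append_of (snd_of (snd_of fst)) (snd_of snd))) (comp_fst hq)) hp

theorem ofForm_of {l : α → LinForm} (hl : RealComputable l) :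
    RealComputable (fun a => WordPoly.ofForm (l a)) :=
  map_of (pair (fst_of snd) (singleton_of (snd_of snd))) hl

theorem wordPow_of {p : α → WordPoly} {n : α → ℕ} (hp : RealComputable p)
    (hn : RealComputable n) : RealComputable (fun a => WordPoly.pow (p a) (n a)) :=
  natRec_of (singleton_of (pair one nil)) (wordMul_of (snd_of snd) (comp_fst hp)) hn

theorem coSym_of {j : α → ℕ} {ls : α → List LinForm} (hj : RealComputable j)
    (hls : RealComputable ls) : RealComputable (fun a => WordPoly.coSym (j a) (ls a)) :=
  flatMap_of (ite_natEq (natAdd_of (length_of snd) (comp_fst hj)) (length_of (comp_fst hls))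
    (foldr_of (singleton_of (pair one nil)) (wordMul_of (ofForm_of (fst_of snd)) (snd_of snd)) snd)
    nil) (sublists'_of hls)

theorem shell_of {ls : α → List LinForm} {k : α → ℕ} (hls : RealComputable ls)
    (hk : RealComputable k) : RealComputable (fun a => WordPoly.shell (ls a) (k a)) :=
  append_of
    (wordMul_of (singleton_of (pair (natCast_of (length_of hls)) nil))
      (wordPow_of (ofForm_of (flatten_of hls)) (natAdd_of hk hk)))
    (flatMap_of (wordMul_of (singleton_of (pair (neg_of one) nil))
      (wordPow_of (ofForm_of (append_of (scale_of const_two snd)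
        (scale_of (neg_of one) (flatten_of (comp_fst hls)))))
        (comp_fst (natAdd_of hk hk)))) hls)

open StronglySimple

theorem tolerance_of {N : α → ℕ} {ls : α → List LinForm} (hN : RealComputable N)
    (hls : RealComputable ls) : RealComputable (fun a => tolerance (N a) (ls a)) :=
  pow_of (div_of (margin_of hN hls) (natCast_of (const_nat 4))) (succ_of (length_of hls))

theorem shellExponent_of {N : α → ℕ} {ls : α → List LinForm} (hN : RealComputable N)
    (hls : RealComputable ls) : RealComputable (fun a => shellExponent (N a) (ls a)) := by
  refine search (t := fun p => p.2 * tolerance (N p.1) (ls p.1) - (ls p.1).length)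
    (sub_of (mul_of (natCast_of snd) (comp_fst (tolerance_of hN hls)))
      (comp_fst (natCast_of (length_of hls)))) fun a => ⟨?_, fun n hn => ?_⟩
  · exact sub_pos.2 (shellExponent_spec (N a) (ls a))
  · exact Nat.find_min (exists_shellExponent (N a) (ls a)) hn

theorem negForm_of {l : α → List ℝ} (hl : RealComputable l) :
    RealComputable (fun a => negForm (l a)) :=
  foldr_of nil (cons_of (pair (neg_of (fst_of snd)) (const_nat 1))
    (map_of (pair (fst_of snd) (succ_of (snd_of snd))) (snd_of snd))) hl

theorem coneForms_of {H : α → List (List ℝ × ℝ)} (hH : RealComputable H) :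
    RealComputable (fun a => coneForms (H a)) :=
  cons_of (singleton_of (pair one zero))
    (map_of (cons_of (pair (snd_of snd) zero) (negForm_of (fst_of snd))) hH)

theorem toExponents_of {d : α → ℕ} {p : α → WordPoly} (hd : RealComputable d)
    (hp : RealComputable p) : RealComputable (fun a => toExponents (d a) (p a)) :=
  map_of (pair (fst_of snd) (map_of (count_of (succ_of snd) (snd_of (snd_of fst)))
    (range_of (comp_fst hd)))) hp

theorem describe_of {d : α → ℕ} {ls : α → List LinForm} (hd : RealComputable d)
    (hls : RealComputable ls) : RealComputable (fun a => describe (d a) (ls a)) :=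
  append_of (map_of (coSym_of snd (comp_fst hls)) (range_of hd))
    (branch (sub_of (natCast_of hd) one)
      (cons_of (ofForm_of (flatten_of hls))
        (singleton_of (shell_of hls (shellExponent_of (succ_of hd) hls)))) nil)

theorem construct_computable : RealComputable construct :=
  map_of (toExponents_of (comp_fst fst) snd)
    (describe_of fst (reduce_of (succ_of fst) (coneForms_of snd)))

end RealComputable

namespace StronglySimple

open LinForm

/-- The homogeneous coordinates of a point, filled up with ones: exponent vectors ignore all further
variables. -/
def homPoint {d : ℕ} (x : Fin d → ℝ) : ℕ → ℝ
  | 0 => 1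
  | i + 1 => if h : i < d then x ⟨i, h⟩ else 1

theorem eval_decodePoly_toExponents {d : ℕ} (x : Fin d → ℝ) (p : WordPoly) :
    MvPolynomial.eval x (decodePoly d (toExponents d p)) = WordPoly.eval (homPoint x) p := by
  have hword : ∀ w : List ℕ, ∏ i : Fin d, x i ^ w.count (i.1 + 1) = (w.map (homPoint x)).prod := by
    intro w
    induction w with
    | nil => simp
    | cons k w ih =>
      rw [List.map_cons, List.prod_cons, ← ih]
      simp only [List.count_cons, pow_add, Finset.prod_mul_distrib]
      rw [mul_comm]
      congr 1
      rcases k with _ | k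
      · simp [homPoint]
      · by_cases h : k < d
        · rw [Finset.prod_eq_single ⟨k, h⟩]
          · simp [homPoint, h]
          · intro i _ hi
            have : k ≠ i.1 := fun h => hi (Fin.ext h.symm)
            simp [this]
          · simp
        · rw [Finset.prod_eq_one]
          · simp [homPoint, h]
          · intro i _
            have : k ≠ i.1 := fun h' => h (h' ▸ i.2)
            simp [this]
  induction p with
  | nil => simp [toExponents, decodePoly, WordPoly.eval]
  | cons t p ih =>
    have h : decodePoly d (toExponents d (t :: p)) =
        MvPolynomial.C t.1 * ∏ i : Fin d, MvPolynomial.X i ^ (t.2.count (i.1 + 1)) +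
          decodePoly d (toExponents d p) := by
      simp [decodePoly, toExponents]
    rw [h, map_add, ih, WordPoly.eval_cons, ← hword]
    simp

theorem eval_negForm {d : ℕ} (a : Fin d → ℝ) (u : ℕ → ℝ) :
    eval u (negForm (List.ofFn a)) = -∑ i, a i * u (i.1 + 1) := by
  induction d generalizing u with
  | zero => simp [negForm, eval]
  | succ d ih =>
    have h : negForm (List.ofFn a) = (-a 0, 1) ::
        (negForm (List.ofFn fun i : Fin d => a i.succ)).map fun t => (t.1, t.2 + 1) := by
      rw [List.ofFn_succ]
      rfl
    have hshift : ∀ l : LinForm,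
        eval u (l.map fun t => (t.1, t.2 + 1)) = eval (fun i => u (i + 1)) l := fun l => by
      simp [eval, Function.comp_def]
    rw [h, eval_cons, hshift, ih, Fin.sum_univ_succ]
    simp only [Fin.val_zero, Fin.val_succ, zero_add]
    ring

theorem suppBelow_negForm {d : ℕ} (a : Fin d → ℝ) :
    SuppBelow (d + 1) (negForm (List.ofFn a)) := by
  induction d with
  | zero => simp [negForm, SuppBelow]
  | succ d ih =>
    have h : negForm (List.ofFn a) = (-a 0, 1) ::
        (negForm (List.ofFn fun i : Fin d => a i.succ)).map fun t => (t.1, t.2 + 1) := by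
      rw [List.ofFn_succ]
      rfl
    rw [h]
    intro t ht
    rcases List.mem_cons.1 ht with rfl | ht
    · simp
    · obtain ⟨t', ht', rfl⟩ := List.mem_map.1 ht
      have := ih _ t' ht'
      simpa using this

theorem suppBelow_coneForms {d m : ℕ} (a : Fin m → Fin d → ℝ) (b : Fin m → ℝ) :
    ∀ l ∈ coneForms (encodeH a b), SuppBelow (d + 1) l := by
  intro l hl t ht
  rcases List.mem_cons.1 hl with rfl | hl
  · rw [List.mem_singleton.1 ht]
    simp
  · obtain ⟨h, hh, rfl⟩ := List.mem_map.1 hl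
    obtain ⟨i, rfl⟩ := List.mem_ofFn.1 hh
    rcases List.mem_cons.1 ht with rfl | ht
    · simp
    · exact suppBelow_negForm (a i) t ht

theorem coneForms_nonneg_iff {d m : ℕ} (a : Fin m → Fin d → ℝ) (b : Fin m → ℝ) (u : ℕ → ℝ) :
    (∀ l ∈ coneForms (encodeH a b), 0 ≤ eval u l) ↔
      0 ≤ u 0 ∧ ∀ i, ∑ k, a i k * u (k.1 + 1) ≤ b i * u 0 := by
  unfold coneForms encodeH
  rw [List.forall_mem_cons]
  refine and_congr (by simp [eval]) ⟨fun h i => ?_, fun h l hl => ?_⟩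
  · have := h _ (List.mem_map_of_mem (List.mem_ofFn.2 ⟨i, rfl⟩))
    rw [eval_cons, eval_negForm] at this
    linarith
  · obtain ⟨h', hh, rfl⟩ := List.mem_map.1 hl
    obtain ⟨i, rfl⟩ := List.mem_ofFn.1 hh
    rw [eval_cons, eval_negForm]
    linarith [h i]

end StronglySimple

/-! ### Active constraints of simple polyhedra -/

section Faces

variable {d : ℕ} {ι : Type*} {φ : ι → (Fin d → ℝ) →ₗ[ℝ] ℝ} {r : ι → ℝ}

/-- The set of the points of a polyhedron at which given constraints are active is an exposed
face. -/
theorem isExposed_active (S : Finset ι) :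
    IsExposed ℝ {y | ∀ i, 0 ≤ φ i y + r i}
      {y | (∀ i, 0 ≤ φ i y + r i) ∧ ∀ i ∈ S, φ i y + r i = 0} := by
  rintro ⟨y₀, hy₀, hy₀S⟩
  refine ⟨(-∑ i ∈ S, φ i).toContinuousLinearMap, ?_⟩
  have hl : ∀ x, (-∑ i ∈ S, φ i).toContinuousLinearMap x =
      ∑ i ∈ S, r i - ∑ i ∈ S, (φ i x + r i) := fun x => by
    simp [Finset.sum_add_distrib]
  ext x
  simp only [Set.mem_ofPred_eq, hl]
  refine and_congr_right fun hx => ⟨fun h y hy => ?_, fun h => ?_⟩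
  · rw [Finset.sum_eq_zero h]
    have := Finset.sum_nonneg fun i (_ : i ∈ S) => hy i
    linarith
  · have h0 := h y₀ hy₀
    rw [Finset.sum_eq_zero hy₀S] at h0
    have hsum : ∑ i ∈ S, (φ i x + r i) = 0 :=
      le_antisymm (by linarith) (Finset.sum_nonneg fun i _ => hx i)
    exact (Finset.sum_eq_zero_iff_of_nonneg fun i _ => hx i).1 hsum

theorem vectorSpan_le_ker {i : ι} {F : Set (Fin d → ℝ)} (hF : ∀ y ∈ F, φ i y + r i = 0) :
    vectorSpan ℝ F ≤ LinearMap.ker (φ i) := by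
  refine Submodule.span_le.2 ?_
  rintro _ ⟨x, hx, y, hy, rfl⟩
  have h1 := hF x hx
  have h2 := hF y hy
  simp only [vsub_eq_sub, SetLike.mem_coe, LinearMap.mem_ker, map_sub]
  linarith

/-- If at some point the constraint `i` is active and all others are strict, then the face defined by
`i` is a facet. -/
theorem hasDim_active_of_strict [Finite ι] {i : ι} (hφ : φ i ≠ 0) {z : Fin d → ℝ} (hz0 : φ i z + r i = 0)
    (hz : ∀ j, j ≠ i → 0 < φ j z + r j) :
    HasDim {y | (∀ j, 0 ≤ φ j y + r j) ∧ φ i y + r i = 0} (d - 1) := by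
  have hnonneg : ∀ j, 0 ≤ φ j z + r j := fun j => by
    by_cases h : j = i
    · rw [h, hz0]
    · exact (hz j h).le
  refine ⟨⟨z, hnonneg, hz0⟩, ?_⟩
  have hspan : vectorSpan ℝ {y | (∀ j, 0 ≤ φ j y + r j) ∧ φ i y + r i = 0} =
      LinearMap.ker (φ i) := by
    refine le_antisymm (vectorSpan_le_ker fun y hy => hy.2) fun v hv => ?_
    rw [LinearMap.mem_ker] at hv
    have hev : ∀ᶠ s : ℝ in nhdsWithin 0 (Set.Ioi 0), ∀ j, 0 ≤ φ j (z + s • v) + r j := by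
      refine Filter.eventually_all.2 fun j => ?_
      by_cases h : j = i
      · refine Filter.Eventually.of_forall fun s => ?_
        rw [h, map_add, map_smul, hv, smul_zero, add_zero, hz0]
      · have hc : Continuous fun s : ℝ => φ j (z + s • v) + r j := by
          simp only [map_add, map_smul]
          fun_prop
        have h0 : 0 < φ j (z + (0 : ℝ) • v) + r j := by simpa using hz j h
        filter_upwards [mem_nhdsWithin_of_mem_nhds (hc.continuousAt.tendsto.eventually_const_lt h0)]
          with s hs using hs.le
    obtain ⟨s, hs, hspos⟩ := (hev.and self_mem_nhdsWithin).exists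
    have hspos : 0 < s := hspos
    have hmem : (z + s • v) -ᵥ z ∈
        vectorSpan ℝ {y | (∀ j, 0 ≤ φ j y + r j) ∧ φ i y + r i = 0} :=
      vsub_mem_vectorSpan ℝ ⟨hs, by rw [map_add, map_smul, hv, smul_zero, add_zero, hz0]⟩
        ⟨hnonneg, hz0⟩
    rw [vsub_eq_sub, add_sub_cancel_left] at hmem
    exact (Submodule.smul_mem_iff _ hspos.ne').1 hmem
  rw [hspan]
  have := Module.Dual.finrank_ker_add_one_of_ne_zero (f := φ i) hφ
  rw [Module.finrank_fin_fun] at this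
  omega

/-- At most `d` constraints of an irredundant description of a simple polyhedron are active at any
of its points: they define distinct facets through a common face. -/
theorem IsSimple.encard_active_le [Fintype ι] (hs : IsSimple {y | ∀ i, 0 ≤ φ i y + r i}) (hd : 1 ≤ d)
    (z : ι → Fin d → ℝ) (hz0 : ∀ i, φ i (z i) + r i = 0)
    (hz : ∀ i j, j ≠ i → 0 < φ j (z i) + r j) {y : Fin d → ℝ} (hy : ∀ i, 0 ≤ φ i y + r i) :
    {i | φ i y + r i = 0}.encard ≤ d := by
  classical
  rcases le_or_gt {i | φ i y + r i = 0}.encard 1 with h1 | h1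
  · exact h1.trans (by exact_mod_cast hd)
  obtain ⟨i₀, j₀, hi₀, hj₀, hij⟩ := Set.one_lt_encard_iff.1 h1
  have hne : ∀ i, φ i ≠ 0 := by
    intro i h
    obtain ⟨j, hj⟩ : ∃ j, j ≠ i := by
      by_cases h : i₀ = i
      · exact ⟨j₀, fun h' => hij (h.trans h'.symm)⟩
      · exact ⟨i₀, h⟩
    have ha := hz0 i
    have hb := hz j i hj.symm
    rw [h, LinearMap.zero_apply] at ha hb
    linarith
  set S : Finset ι := Finset.univ.filter fun i => φ i y + r i = 0 with hS
  have hmemS : ∀ i, i ∈ S ↔ φ i y + r i = 0 := fun i => by simp [hS]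
  set F : Set (Fin d → ℝ) := {x | (∀ i, 0 ≤ φ i x + r i) ∧ ∀ i ∈ S, φ i x + r i = 0} with hF
  have hyF : y ∈ F := ⟨hy, fun i hi => (hmemS i).1 hi⟩
  have hk : Module.finrank ℝ (vectorSpan ℝ F) < d := by
    have hle : vectorSpan ℝ F ≤ LinearMap.ker (φ i₀) :=
      vectorSpan_le_ker fun x hx => hx.2 i₀ ((hmemS i₀).2 hi₀)
    have hlt := Submodule.finrank_lt (s := LinearMap.ker (φ i₀))
      (by rw [Ne, LinearMap.ker_eq_top]; exact hne i₀)
    rw [Module.finrank_fin_fun] at hlt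
    exact (Submodule.finrank_mono hle).trans_lt hlt
  have hcard := hs.2 _ hk F ⟨isExposed_active S, ⟨y, hyF⟩, rfl⟩
  let G : ι → Set (Fin d → ℝ) := fun i => {x | (∀ j, 0 ≤ φ j x + r j) ∧ φ i x + r i = 0}
  have hle : {i | φ i y + r i = 0}.encard ≤
      {G | IsFaceOfDim {y | ∀ i, 0 ≤ φ i y + r i} (d - 1) G ∧ F ⊆ G}.encard := by
    refine Set.encard_le_encard_of_injOn (f := G) (fun i hi => ⟨⟨?_, ?_⟩, ?_⟩) ?_
    · simpa [G] using isExposed_active (φ := φ) (r := r) {i}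
    · exact hasDim_active_of_strict (hne i) (hz0 i) (hz i)
    · exact fun x hx => ⟨hx.1, hx.2 i ((hmemS i).2 hi)⟩
    · intro i _ j _ hij
      by_contra hne'
      have hmem : z i ∈ G i := ⟨fun k => by
        by_cases h : k = i
        · rw [h, hz0]
        · exact (hz i k h).le, hz0 i⟩
      rw [hij] at hmem
      exact (hz i j (Ne.symm hne')).ne' hmem.2
  rw [hcard] at hle
  exact hle.trans (by exact_mod_cast Nat.sub_le _ _)

end Faces

/-! ### The cone over a strongly simple polyhedron -/

section Cone

variable {d : ℕ} {ι : Type*} {L : ι → ((Fin d → ℝ) × ℝ) →ₗ[ℝ] ℝ}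

/-- The cone over a `d`-dimensional polyhedron contains a point at which all constraints are
strict. -/
theorem exists_strict_point [Fintype ι] (hP : HasDim {x | ∀ i, 0 ≤ L i (x, 1)} d)
    (hL : ∀ i, L i ≠ 0) : ∃ p, ∀ i, 0 < L i p := by
  obtain ⟨⟨x₀, hx₀⟩, hdim⟩ := hP
  have htop : vectorSpan ℝ {x | ∀ i, 0 ≤ L i (x, 1)} = ⊤ :=
    Submodule.eq_top_of_finrank_eq (by rw [hdim, Module.finrank_fin_fun])
  have hex : ∀ i, ∃ x : Fin d → ℝ, (∀ j, 0 ≤ L j (x, 1)) ∧ 0 < L i (x, 1) := by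
    intro i
    by_contra hcon
    push Not at hcon
    have hzero : ∀ x : Fin d → ℝ, (∀ j, 0 ≤ L j (x, 1)) → L i (x, 1) = 0 := fun x hx =>
      le_antisymm (hcon x hx) (hx i)
    have hle : vectorSpan ℝ {x | ∀ i, 0 ≤ L i (x, 1)} ≤
        LinearMap.ker (L i ∘ₗ LinearMap.inl ℝ (Fin d → ℝ) ℝ) := by
      refine Submodule.span_le.2 ?_
      rintro _ ⟨x, hx, y, hy, rfl⟩
      have h : ((x - y, 0) : (Fin d → ℝ) × ℝ) = (x, 1) - (y, 1) := by simp
      simp only [vsub_eq_sub, SetLike.mem_coe, LinearMap.mem_ker, LinearMap.comp_apply,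
        LinearMap.inl_apply]
      rw [h, map_sub, hzero x hx, hzero y hy, sub_zero]
    rw [htop] at hle
    have h0 : ∀ v, L i (v, 0) = 0 := fun v => hle (Submodule.mem_top (x := v))
    refine hL i (LinearMap.ext fun u => ?_)
    have h : u = (u.1 - u.2 • x₀, 0) + u.2 • (x₀, 1) := by ext <;> simp
    rw [h, map_add, map_smul, h0, hzero x₀ hx₀, smul_zero, add_zero, LinearMap.zero_apply]
  choose x hx hpos using hex
  refine ⟨∑ i, (x i, 1), fun j => ?_⟩
  rw [map_sum]
  exact Finset.sum_pos' (fun i _ => hx i j) ⟨j, Finset.mem_univ j, hpos j⟩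

/-- For every constraint of an irredundant system there is a point at which it is the only active
one. -/
theorem exists_facet_point [Fintype ι] (hP : HasDim {x | ∀ i, 0 ≤ L i (x, 1)} d)
    (hirr : ∀ i, ∃ u, L i u < 0 ∧ ∀ j, j ≠ i → 0 ≤ L j u) (i : ι) :
    ∃ w, L i w = 0 ∧ ∀ j, j ≠ i → 0 < L j w := by
  obtain ⟨p, hp⟩ := exists_strict_point hP fun i h => by
    obtain ⟨u, hu, -⟩ := hirr i
    rw [h, LinearMap.zero_apply] at hu
    exact lt_irrefl _ hu
  obtain ⟨u, hu, hj⟩ := hirr i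
  refine ⟨(-L i u) • p + L i p • u, ?_, fun j hji => ?_⟩
  · simp only [map_add, map_smul, smul_eq_mul]
    ring
  · simp only [map_add, map_smul, smul_eq_mul]
    exact add_pos_of_pos_of_nonneg (mul_pos (by linarith) (hp j)) (mul_nonneg (hp i).le (hj j hji))

/-- A permissible projective transformation of a nonempty polyhedron comes from a linear automorphism
of the homogeneous coordinates which maps the polyhedron to points with positive last coordinate. -/
theorem ProjTransformation.exists_linearEquiv (f : ProjTransformation d)
    (hf : f.Permissible {x | ∀ i, 0 ≤ L i (x, 1)}) :
    ∃ T : ((Fin d → ℝ) × ℝ) ≃ₗ[ℝ] ((Fin d → ℝ) × ℝ),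
      (∀ x : Fin d → ℝ, (∀ i, 0 ≤ L i (x, 1)) → 0 < (T (x, 1)).2) ∧
      ∀ x, f.toFun x = (T (x, 1)).2⁻¹ • (T (x, 1)).1 := by
  obtain ⟨ε, hε0, hε⟩ : ∃ ε : ℝ, ε ≠ 0 ∧
      ∀ x : Fin d → ℝ, (∀ i, 0 ≤ L i (x, 1)) → 0 < ε * f.denom x := by
    by_cases h : ∀ x : Fin d → ℝ, (∀ i, 0 ≤ L i (x, 1)) → 0 < f.denom x
    · exact ⟨1, one_ne_zero, fun x hx => by rw [one_mul]; exact h x hx⟩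
    · push Not at h
      obtain ⟨x, hx, hx0⟩ := h
      have hx0 : f.denom x < 0 := lt_of_le_of_ne hx0 (hf x hx)
      refine ⟨-1, by norm_num, fun y hy => ?_⟩
      by_contra hy0
      have hy0 : 0 ≤ f.denom y := by linarith
      -- the point of the segment from `x` to `y` at which the denominator vanishes
      have hden : 0 < f.denom y - f.denom x := by linarith
      set s := f.denom y / (f.denom y - f.denom x) with hs
      have hs0 : 0 ≤ s := div_nonneg hy0 hden.le
      have hs1 : s ≤ 1 := (div_le_one hden).2 (by linarith)
      refine hf (s • x + (1 - s) • y) (fun i => ?_) ?_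
      · have h : ((s • x + (1 - s) • y, 1) : (Fin d → ℝ) × ℝ) =
            s • (x, 1) + (1 - s) • (y, 1) := by ext <;> simp
        rw [h, map_add, map_smul, map_smul]
        exact add_nonneg (mul_nonneg hs0 (hx i)) (mul_nonneg (by linarith) (hy i))
      · have h : f.denom (s • x + (1 - s) • y) = s * f.denom x + (1 - s) * f.denom y := by
          simp only [denom, dotProduct_add, dotProduct_smul, smul_eq_mul]
          ring
        rw [h, hs]
        field_simp
        ring
  let T₀ : ((Fin d → ℝ) × ℝ) →ₗ[ℝ] ((Fin d → ℝ) × ℝ) :=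
    { toFun := fun u => ε • (f.A.mulVec u.1 + u.2 • f.v, f.c ⬝ᵥ u.1 + u.2 * f.δ)
      map_add' := fun u w => by
        ext <;> simp [Matrix.mulVec_add] <;> ring
      map_smul' := fun t u => by
        ext <;> simp [Matrix.mulVec_smul] <;> ring }
  have hinj : Function.Injective T₀ := by
    rw [← LinearMap.ker_eq_bot, LinearMap.ker_eq_bot']
    intro u hu
    have hu' : (f.A.mulVec u.1 + u.2 • f.v, f.c ⬝ᵥ u.1 + u.2 * f.δ) =
        (0 : (Fin d → ℝ) × ℝ) := (smul_eq_zero.1 hu).resolve_left hε0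
    have h1 : f.A.mulVec u.1 + u.2 • f.v = 0 := congrArg Prod.fst hu'
    have h2 : f.c ⬝ᵥ u.1 + u.2 * f.δ = 0 := congrArg Prod.snd hu'
    have h := Matrix.eq_zero_of_mulVec_eq_zero f.det_ne_zero
      (v := Sum.elim u.1 fun _ => u.2) (by
        rw [Matrix.fromBlocks_mulVec]
        ext i
        rcases i with i | i
        · have := congrFun h1 i
          simp [Matrix.mulVec, dotProduct] at this ⊢
          linarith
        · simp [Matrix.mulVec, dotProduct] at h2 ⊢
          linarith)
    refine Prod.ext (funext fun i => ?_) ?_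
    · exact congrFun h (Sum.inl i)
    · exact congrFun h (Sum.inr ())
  have hT2 : ∀ x, (T₀ (x, 1)).2 = ε * f.denom x := fun x => by
    simp [T₀, denom]
  have hT1 : ∀ x, (T₀ (x, 1)).1 = ε • (f.A.mulVec x + f.v) := fun x => by
    simp [T₀]
  refine ⟨LinearEquiv.ofInjectiveEndo T₀ hinj, fun x hx => ?_, fun x => ?_⟩
  · rw [LinearEquiv.coe_ofInjectiveEndo, hT2]
    exact hε x hx
  · rw [LinearEquiv.coe_ofInjectiveEndo, hT1, hT2, toFun, smul_smul]
    congr 1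
    rw [mul_inv, mul_assoc, mul_comm _ ε, ← mul_assoc, inv_mul_cancel₀ hε0, one_mul]

variable (T : ((Fin d → ℝ) × ℝ) ≃ₗ[ℝ] ((Fin d → ℝ) × ℝ))

theorem mem_of_cone {u : (Fin d → ℝ) × ℝ} (hu : ∀ i, 0 ≤ L i u) (hu2 : 0 < u.2) (i : ι) :
    0 ≤ L i (u.2⁻¹ • u.1, 1) := by
  have h : ((u.2⁻¹ • u.1, 1) : (Fin d → ℝ) × ℝ) = u.2⁻¹ • u := by
    ext
    · simp
    · simp [hu2.ne']
  rw [h, map_smul]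
  exact mul_nonneg (inv_nonneg.2 hu2.le) (hu i)

/-- The image of a polyhedron being bounded, its denominator is positive on the whole cone, including
the directions at infinity. -/
theorem denom_pos_on_cone (hs : ∀ u, (∀ i, 0 ≤ L i u) → 0 ≤ u.2)
    (hP : {x : Fin d → ℝ | ∀ i, 0 ≤ L i (x, 1)}.Nonempty)
    (hT : ∀ x : Fin d → ℝ, (∀ i, 0 ≤ L i (x, 1)) → 0 < (T (x, 1)).2)
    (hb : Bornology.IsBounded ((fun x => (T (x, 1)).2⁻¹ • (T (x, 1)).1) ''
      {x : Fin d → ℝ | ∀ i, 0 ≤ L i (x, 1)}))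
    {u : (Fin d → ℝ) × ℝ} (hu : ∀ i, 0 ≤ L i u) (hu0 : u ≠ 0) : 0 < (T u).2 := by
  rcases (hs u hu).eq_or_lt with hu2 | hu2
  · obtain ⟨p, hp⟩ := hP
    have hray : ∀ s : ℝ, ((p + s • u.1, 1) : (Fin d → ℝ) × ℝ) = (p, 1) + s • u := fun s => by
      ext
      · simp
      · simp [← hu2]
    have hmem : ∀ s : ℝ, 0 ≤ s → ∀ i, 0 ≤ L i (p + s • u.1, 1) := fun s hs0 i => by
      rw [hray, map_add, map_smul]
      exact add_nonneg (hp i) (mul_nonneg hs0 (hu i))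
    have hden : ∀ s : ℝ, 0 ≤ s → 0 < (T (p, 1)).2 + s * (T u).2 := fun s hs0 => by
      have := hT _ (hmem s hs0)
      rw [hray, map_add, map_smul] at this
      simpa using this
    have hp2 := hT p hp
    have h0 : 0 ≤ (T u).2 := by
      by_contra hneg
      push Not at hneg
      have := hden ((T (p, 1)).2 / -(T u).2) (div_nonneg hp2.le (by linarith))
      have hne : (T u).2 ≠ 0 := hneg.ne
      field_simp at this
      linarith
    refine lt_of_le_of_ne h0 fun h0 => hu0 ?_
    -- otherwise the image contains a ray in the direction `(T u).1`
    obtain ⟨C, hC⟩ := hb.exists_norm_le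
    have hbound : ∀ n : ℕ, (n : ℝ) * ‖(T u).1‖ ≤ (T (p, 1)).2 * C + ‖(T (p, 1)).1‖ := by
      intro n
      have h := hC _ ⟨_, hmem n n.cast_nonneg, rfl⟩
      have h1 : (T (p + (n : ℝ) • u.1, 1)).2 = (T (p, 1)).2 := by
        rw [hray, map_add, map_smul]
        simp [← h0]
      have h2 : (T (p + (n : ℝ) • u.1, 1)).1 = (T (p, 1)).1 + (n : ℝ) • (T u).1 := by
        rw [hray, map_add, map_smul]
        simp
      simp only [h1, h2] at h
      rw [norm_smul, norm_inv, Real.norm_of_nonneg hp2.le, inv_mul_le_iff₀ hp2] at h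
      have h3 : ‖(n : ℝ) • (T u).1‖ ≤ ‖(T (p, 1)).1 + (n : ℝ) • (T u).1‖ + ‖(T (p, 1)).1‖ := by
        have := norm_sub_le ((T (p, 1)).1 + (n : ℝ) • (T u).1) (T (p, 1)).1
        rwa [add_sub_cancel_left] at this
      rw [norm_smul, Real.norm_of_nonneg n.cast_nonneg] at h3
      linarith
    have hnorm : (T u).1 = 0 := by
      by_contra hne
      have hpos : 0 < ‖(T u).1‖ := norm_pos_iff.2 hne
      obtain ⟨n, hn⟩ := exists_nat_gt (((T (p, 1)).2 * C + ‖(T (p, 1)).1‖) / ‖(T u).1‖)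
      rw [div_lt_iff₀ hpos] at hn
      exact (hbound n).not_gt hn
    exact T.map_eq_zero_iff.1 (Prod.ext hnorm h0.symm)
  · have h := hT _ (mem_of_cone hu hu2)
    have h' : ((u.2⁻¹ • u.1, 1) : (Fin d → ℝ) × ℝ) = u.2⁻¹ • u := by
      ext
      · simp
      · simp [hu2.ne']
    rw [h', map_smul] at h
    exact (mul_pos_iff_of_pos_left (inv_pos.2 hu2)).1 h

/-- The closure of the projective image of a polyhedron, as a section of the cone over it. -/
theorem closure_image_eq (hs : ∀ u, (∀ i, 0 ≤ L i u) → 0 ≤ u.2)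
    (hP : {x : Fin d → ℝ | ∀ i, 0 ≤ L i (x, 1)}.Nonempty)
    (hT : ∀ x : Fin d → ℝ, (∀ i, 0 ≤ L i (x, 1)) → 0 < (T (x, 1)).2) :
    closure ((fun x => (T (x, 1)).2⁻¹ • (T (x, 1)).1) ''
      {x : Fin d → ℝ | ∀ i, 0 ≤ L i (x, 1)}) = {y | ∀ i, 0 ≤ L i (T.symm (y, 1))} := by
  refine Set.Subset.antisymm (closure_minimal ?_ ?_) fun y hy => ?_
  · rintro _ ⟨x, hx, rfl⟩ i
    have hpos := hT x hx
    have h : (((T (x, 1)).2⁻¹ • (T (x, 1)).1, 1) : (Fin d → ℝ) × ℝ) =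
        (T (x, 1)).2⁻¹ • T (x, 1) := by
      ext
      · simp
      · simp [hpos.ne']
    simp only
    rw [h, map_smul, LinearEquiv.symm_apply_apply, map_smul]
    exact mul_nonneg (inv_nonneg.2 hpos.le) (hx i)
  · simp only [Set.ofPred_forall]
    refine isClosed_iInter fun i => isClosed_le continuous_const ?_
    have hc : Continuous (L i ∘ₗ T.symm.toLinearMap) := LinearMap.continuous_of_finiteDimensional _
    exact hc.comp (by fun_prop : Continuous fun y : Fin d → ℝ => (y, (1 : ℝ)))
  · obtain ⟨p, hp⟩ := hP
    have hy2 := hs _ hy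
    set u := T.symm (y, 1) with hu
    have hTu : T u = (y, 1) := T.apply_symm_apply _
    have hp2 := hT p hp
    -- move `u` towards the point `p` of the polyhedron, away from infinity
    have htend : Filter.Tendsto
        (fun s : ℝ => (1 + s * (T (p, 1)).2)⁻¹ • (y + s • (T (p, 1)).1))
        (nhdsWithin 0 (Set.Ioi 0)) (nhds y) := by
      have hc : ContinuousAt
          (fun s : ℝ => (1 + s * (T (p, 1)).2)⁻¹ • (y + s • (T (p, 1)).1)) 0 := by
        have h1 : ContinuousAt (fun s : ℝ => (1 + s * (T (p, 1)).2)⁻¹) 0 :=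
          ContinuousAt.inv₀ (by fun_prop) (by simp)
        have h2 : ContinuousAt (fun s : ℝ => y + s • (T (p, 1)).1) 0 := by fun_prop
        exact h1.smul h2
      have := hc.tendsto
      simp only [zero_mul, add_zero, inv_one, zero_smul, one_smul] at this
      exact this.mono_left nhdsWithin_le_nhds
    refine mem_closure_of_tendsto htend ?_
    filter_upwards [self_mem_nhdsWithin] with s hs0
    have hs0 : 0 < s := hs0
    set w := u + s • ((p, 1) : (Fin d → ℝ) × ℝ) with hw
    have hw2 : 0 < w.2 := by
      simp [hw]
      linarith
    have hwK : ∀ i, 0 ≤ L i w := fun i => by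
      rw [hw, map_add, map_smul]
      exact add_nonneg (hy i) (mul_nonneg hs0.le (hp i))
    refine ⟨w.2⁻¹ • w.1, mem_of_cone hwK hw2, ?_⟩
    have h' : ((w.2⁻¹ • w.1, 1) : (Fin d → ℝ) × ℝ) = w.2⁻¹ • w := by
      ext
      · simp
      · simp [hw2.ne']
    have hTw : T w = (y + s • (T (p, 1)).1, 1 + s * (T (p, 1)).2) := by
      rw [hw, map_add, map_smul, hTu]
      ext <;> simp
    simp only [h', map_smul, Prod.smul_fst, Prod.smul_snd, smul_smul, hTw, smul_eq_mul]
    congr 1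
    have : 1 + s * (T (p, 1)).2 ≠ 0 := by positivity
    field_simp

/-- At most `d` constraints of an irredundant description of the cone over a strongly simple
polyhedron are active at any nonzero point of the cone. -/
theorem IsStronglySimple.encard_active_le [Fintype ι] (hd : 1 ≤ d)
    (hs : ∀ u, (∀ i, 0 ≤ L i u) → 0 ≤ u.2)
    (hP : HasDim {x | ∀ i, 0 ≤ L i (x, 1)} d)
    (hss : IsStronglySimple {x | ∀ i, 0 ≤ L i (x, 1)})
    (hirr : ∀ i, ∃ u, L i u < 0 ∧ ∀ j, j ≠ i → 0 ≤ L j u)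
    {u : (Fin d → ℝ) × ℝ} (hu : ∀ i, 0 ≤ L i u) (hu0 : u ≠ 0) :
    {i | L i u = 0}.encard ≤ d := by
  rcases le_or_gt {i | L i u = 0}.encard 1 with h1 | h1
  · exact h1.trans (by exact_mod_cast hd)
  obtain ⟨i₀, j₀, -, -, hij⟩ := Set.one_lt_encard_iff.1 h1
  obtain ⟨f, hf, hpoly, hsimple⟩ := hss
  obtain ⟨T, hT, hfT⟩ := f.exists_linearEquiv hf
  have hfT' : f.toFun = fun x => (T (x, 1)).2⁻¹ • (T (x, 1)).1 := funext hfT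
  rw [hfT'] at hpoly hsimple
  have hpos : ∀ {w : (Fin d → ℝ) × ℝ}, (∀ i, 0 ≤ L i w) → w ≠ 0 → 0 < (T w).2 :=
    denom_pos_on_cone T hs hP.1 hT (hpoly.2.subset subset_closure)
  let φ : ι → (Fin d → ℝ) →ₗ[ℝ] ℝ := fun i =>
    L i ∘ₗ T.symm.toLinearMap ∘ₗ LinearMap.inl ℝ (Fin d → ℝ) ℝ
  let r : ι → ℝ := fun i => L i (T.symm (0, 1))
  have hφ : ∀ i y, φ i y + r i = L i (T.symm (y, 1)) := fun i y => by
    have h : ((y, 1) : (Fin d → ℝ) × ℝ) = (y, 0) + (0, 1) := by simp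
    rw [h, map_add, map_add]
    rfl
  have hnormal : ∀ {w : (Fin d → ℝ) × ℝ}, 0 < (T w).2 → ∀ i,
      φ i ((T w).2⁻¹ • (T w).1) + r i = (T w).2⁻¹ * L i w := fun {w} hw i => by
    have h : (((T w).2⁻¹ • (T w).1, 1) : (Fin d → ℝ) × ℝ) = (T w).2⁻¹ • T w := by
      ext
      · simp
      · simp [hw.ne']
    rw [hφ, h, map_smul, LinearEquiv.symm_apply_apply, map_smul, smul_eq_mul]
  have hQ := closure_image_eq T hs hP.1 hT
  rw [hQ] at hsimple
  simp only [← hφ] at hsimple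
  choose w hw0 hw using exists_facet_point hP hirr
  have hwK : ∀ i j, 0 ≤ L j (w i) := fun i j => by
    by_cases h : j = i
    · rw [h, hw0]
    · exact (hw i j h).le
  have hwne : ∀ i, w i ≠ 0 := by
    intro i h
    obtain ⟨j, hj⟩ : ∃ j, j ≠ i := by
      by_cases h : i₀ = i
      · exact ⟨j₀, fun h' => hij (h.trans h'.symm)⟩
      · exact ⟨i₀, h⟩
    have := hw i j hj
    rw [h, map_zero] at this
    exact lt_irrefl _ this
  have hwpos : ∀ i, 0 < (T (w i)).2 := fun i => hpos (hwK i) (hwne i)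
  have hupos : 0 < (T u).2 := hpos hu hu0
  have key := hsimple.encard_active_le hd (fun i => (T (w i)).2⁻¹ • (T (w i)).1)
    (fun i => by rw [hnormal (hwpos i), hw0, mul_zero])
    (fun i j hji => by
      rw [hnormal (hwpos i)]
      exact mul_pos (inv_pos.2 (hwpos i)) (hw i j hji))
    (y := (T u).2⁻¹ • (T u).1) (fun i => by
      rw [hnormal hupos]
      exact mul_nonneg (inv_nonneg.2 hupos.le) (hu i))
  have hset : {i | L i u = 0} = {i | φ i ((T u).2⁻¹ • (T u).1) + r i = 0} := by
    ext i
    rw [Set.mem_ofPred_eq, Set.mem_ofPred_eq, hnormal hupos]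
    simp [hupos.ne']
  rwa [hset]

end Cone

/-! ### The described set -/

namespace List

theorem coSym_nonneg {xs : List ℝ} (h : ∀ x ∈ xs, 0 ≤ x) (j : ℕ) : 0 ≤ coSym j xs := by
  refine sum_nonneg fun y hy => ?_
  obtain ⟨I, hI, rfl⟩ := mem_map.1 hy
  split_ifs
  · exact prod_nonneg fun x hx => h x ((mem_sublists'.1 hI).subset hx)
  · exact le_rfl

theorem coSym_map_mul_nonneg {c : ℝ} (hc : 0 ≤ c) {j : ℕ} {xs : List ℝ} (h : 0 ≤ coSym j xs) :
    0 ≤ coSym j (xs.map fun x => c * x) := by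
  have hprod : ∀ I : List ℝ, (I.map fun x => c * x).prod = I.prod * c ^ I.length := by
    intro I
    induction I with
    | nil => simp
    | cons x I ih => rw [map_cons, prod_cons, prod_cons, ih, length_cons, pow_succ]; ring
  have heq : coSym j (xs.map fun x => c * x) = coSym j xs * c ^ (xs.length - j) := by
    unfold coSym
    rw [← sum_map_mul_const, sublists'_map, map_map]
    congr 1
    refine map_congr_left fun I _ => ?_
    simp only [Function.comp_apply, length_map]
    split_ifs with hI
    · rw [hprod, ← hI, Nat.add_sub_cancel]
    · rw [zero_mul]
  rw [heq]
  positivity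

theorem coSym_zero (xs : List ℝ) : coSym 0 xs = xs.prod := by
  unfold coSym
  induction xs with
  | nil => simp
  | cons x xs ih =>
    rw [sublists'_cons, map_append, sum_append, map_map, prod_cons, ← ih, mul_comm,
      ← sum_map_mul_const]
    have h0 : (xs.sublists'.map fun I : List ℝ =>
        if I.length + 0 = (x :: xs).length then I.prod else 0).sum = 0 := by
      refine sum_eq_zero fun y hy => ?_
      obtain ⟨I, hI, rfl⟩ := mem_map.1 hy
      have := length_le_of_mem_sublists' hI
      rw [length_cons, if_neg (by omega)]
    rw [h0, zero_add]
    congr 1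
    refine map_congr_left fun I _ => ?_
    simp only [Function.comp_apply, length_cons, prod_cons, add_zero, Nat.add_right_cancel_iff]
    split_ifs
    · ring
    · ring

theorem countP_eq_card_filter {α : Type} (l : List α) (p : α → Prop) [DecidablePred p] :
    l.countP (fun a => p a) = (Finset.univ.filter fun i : Fin l.length => p l[i]).card := by
  rw [Finset.card_filter]
  refine Eq.trans ?_ (Fin.sum_univ_fun_getElem l fun a => if p a then 1 else 0).symm
  induction l with
  | nil => rfl
  | cons a l ih =>
    rw [countP_cons, ih, map_cons, sum_cons, add_comm]
    simp

end List

namespace StronglySimple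

open LinForm

variable {d : ℕ}

/-- The sequence `u₀, u₁, …` of homogeneous coordinates of a point `(x, s)`, filled up with zeros. -/
def homSeq (u : (Fin d → ℝ) × ℝ) : ℕ → ℝ
  | 0 => u.2
  | i + 1 => if h : i < d then u.1 ⟨i, h⟩ else 0

/-- A form as a linear functional on homogeneous coordinates. -/
def functional (l : LinForm) : ((Fin d → ℝ) × ℝ) →ₗ[ℝ] ℝ where
  toFun u := eval (homSeq u) l
  map_add' u w := by
    rw [← eval_add]
    congr 1
    funext k
    rcases k with _ | k
    · rfl
    · by_cases h : k < d <;> simp [homSeq, h]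
  map_smul' c u := by
    rw [RingHom.id_apply, smul_eq_mul, ← eval_smul]
    congr 1
    funext k
    rcases k with _ | k
    · rfl
    · by_cases h : k < d <;> simp [homSeq, h]

theorem functional_eq_eval {l : LinForm} (hl : SuppBelow (d + 1) l) (u : ℕ → ℝ) :
    functional l (fun k : Fin d => u (k + 1), u 0) = eval u l := by
  refine eval_congr hl fun k hk => ?_
  rcases k with _ | k
  · rfl
  · have : k < d := by omega
    simp [homSeq, this]

theorem functional_eq_eval_homPoint {l : LinForm} (hl : SuppBelow (d + 1) l) (x : Fin d → ℝ) :
    functional l (x, 1) = eval (homPoint x) l := by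
  refine eval_congr hl fun k hk => ?_
  rcases k with _ | k
  · rfl
  · have : k < d := by omega
    simp [homSeq, homPoint, this]

theorem shell_nonneg {ls : List LinForm} {u : ℕ → ℝ} (hu : ∀ l ∈ ls, 0 ≤ eval u l) (k : ℕ) :
    0 ≤ WordPoly.eval u (WordPoly.shell ls k) := by
  rw [WordPoly.eval_shell, sub_nonneg]
  have h := List.sum_le_card_nsmul
    (ls.map fun l => (2 * eval u l - eval u ls.flatten) ^ (k + k)) (eval u ls.flatten ^ (k + k))
    (fun y hy => by
      obtain ⟨l, hl, rfl⟩ := List.mem_map.1 hy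
      have h0 := hu l hl
      have h1 : eval u l ≤ eval u ls.flatten := by
        rw [eval_flatten]
        refine List.single_le_sum (fun y hy => ?_) _ (List.mem_map_of_mem hl)
        obtain ⟨l', hl', rfl⟩ := List.mem_map.1 hy
        exact hu l' hl'
      rw [← Even.pow_abs (Even.add_self k)]
      exact pow_le_pow_left₀ (abs_nonneg _) (abs_le.2 ⟨by linarith, by linarith⟩) _)
  rwa [List.length_map, nsmul_eq_mul] at h

/-- A bound from Bernoulli's inequality. -/
theorem abs_le_of_pow_le {k m : ℕ} {η y : ℝ} (hη : 0 < η) (hk : (m : ℝ) < k * η)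
    (hy : y ^ (k + k) ≤ m) : |y| ≤ 1 + η := by
  by_contra h
  push Not at h
  have h1 : (1 + η) ^ (k + k) ≤ |y| ^ (k + k) := pow_le_pow_left₀ (by linarith) h.le _
  rw [Even.pow_abs (Even.add_self k)] at h1
  have h2 := one_add_mul_le_pow (show (-2 : ℝ) ≤ η by linarith) (k + k)
  push_cast at h2
  have : (0 : ℝ) ≤ k * η := by positivity
  linarith

theorem tolerance_lt (N : ℕ) (ls : List LinForm) :
    4 ^ ls.length * tolerance N ls < margin N ls ^ ls.length := by
  have hpos := margin_pos N ls
  have h1 : margin N ls ≤ 1 := minOne_le_one _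
  have h : (4 : ℝ) ^ ls.length * tolerance N ls = margin N ls ^ ls.length * (margin N ls / 4) := by
    rw [tolerance, pow_succ, div_pow]
    push_cast
    field_simp
  rw [h]
  exact mul_lt_of_lt_one_right (pow_pos hpos _) (by linarith)

theorem tolerance_le (N : ℕ) (ls : List LinForm) : tolerance N ls ≤ margin N ls := by
  have hpos := margin_pos N ls
  have h1 : margin N ls ≤ 1 := minOne_le_one _
  rw [tolerance]
  push_cast
  refine (pow_le_of_le_one (by positivity) (by linarith) (Nat.succ_ne_zero _)).trans (by linarith)

/-- The polynomials of `describe` characterize the cone if at most `d` forms are active at its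
nonzero points. -/
theorem nonneg_of_describe {N : ℕ} {ls : List LinForm} (hls : ∀ l ∈ ls, SuppBelow N l)
    (hcount : ∀ v, (∀ l ∈ ls, 0 ≤ eval v l) → 1 ≤ eval v ls.flatten →
      ls.countP (fun l => eval v l = 0) ≤ d) {u : ℕ → ℝ}
    (hsym : ∀ j < d, 0 ≤ List.coSym j (ls.map (eval u))) (hsum : 0 ≤ eval u ls.flatten)
    (hshell : 0 ≤ WordPoly.eval u (WordPoly.shell ls (shellExponent N ls))) :
    ∀ l ∈ ls, 0 ≤ eval u l := by
  set k := shellExponent N ls with hk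
  set η := tolerance N ls with hη
  set σ := eval u ls.flatten with hσ
  have hηpos : 0 < η := tolerance_pos N ls
  have hkη : (ls.length : ℝ) < k * η := shellExponent_spec N ls
  have hk0 : k ≠ 0 := by
    intro h
    rw [h, Nat.cast_zero, zero_mul] at hkη
    exact (Nat.cast_nonneg _).not_gt hkη
  rw [WordPoly.eval_shell, sub_nonneg] at hshell
  have hterm : ∀ l ∈ ls, (2 * eval u l - σ) ^ (k + k) ≤ ls.length * σ ^ (k + k) := fun l hl => by
    refine le_trans ?_ hshell
    refine List.single_le_sum (fun y hy => ?_) _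
      (List.mem_map_of_mem (f := fun l => (2 * eval u l - σ) ^ (k + k)) hl)
    obtain ⟨l', -, rfl⟩ := List.mem_map.1 hy
    exact (Even.add_self k).pow_nonneg _
  rcases hsum.eq_or_lt with hσ0 | hσ0
  · intro l hl
    have h := hterm l hl
    rw [← hσ0, zero_pow (by omega), mul_zero, sub_zero] at h
    have h0 := pow_eq_zero_iff (by omega : k + k ≠ 0) |>.1
      (le_antisymm h ((Even.add_self k).pow_nonneg _))
    linarith
  · -- normalize to `σ = 1`
    have hw : ∀ l, eval (σ⁻¹ • u) l = σ⁻¹ * eval u l := eval_smul σ⁻¹ u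
    set w := σ⁻¹ • u with hwdef
    have hbound : ∀ l ∈ ls, |2 * eval w l - 1| ≤ 1 + η := fun l hl => by
      refine abs_le_of_pow_le hηpos hkη ?_
      have h : 2 * eval w l - 1 = (2 * eval u l - σ) / σ := by
        rw [hw]
        field_simp
      rw [h, div_pow, div_le_iff₀ (by positivity)]
      exact hterm l hl
    have hη1 : η ≤ 1 := (tolerance_le N ls).trans (minOne_le_one _)
    have hlow : ∀ l ∈ ls, -η ≤ eval w l ∧ eval w l ≤ 2 := fun l hl => by
      have := abs_le.1 (hbound l hl)
      constructor <;> linarith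
    have hw1 : eval w ls.flatten = 1 := by
      rw [hw]
      exact inv_mul_cancel₀ hσ0.ne'
    obtain ⟨v, hv1, hv, hv0⟩ := exists_of_margin hls hw1.ge fun l hl =>
      (neg_le_neg (tolerance_le N ls)).trans (hlow l hl).1
    have hxs : ls.map (eval w) = (ls.map (eval u)).map fun x => σ⁻¹ * x := by
      rw [List.map_map]
      exact List.map_congr_left fun l _ => hw l
    have key := List.nonneg_of_coSym_nonneg (d := d) (xs := ls.map (eval w)) hηpos.le
      (margin_pos N ls) (minOne_le_one _) (by rw [List.length_map]; exact tolerance_lt N ls)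
      (fun x hx => by
        obtain ⟨l, hl, rfl⟩ := List.mem_map.1 hx
        exact hlow l hl)
      (by
        rw [List.countP_map]
        refine le_trans (List.countP_mono_left fun l hl h => ?_) (hcount v hv hv1)
        simp only [Function.comp_apply, decide_eq_true_eq] at h ⊢
        exact hv0 l hl h)
      (fun j hj => by
        rw [hxs]
        exact List.coSym_map_mul_nonneg (inv_nonneg.2 hσ0.le) (hsym j hj))
    intro l hl
    have h := key _ (List.mem_map_of_mem hl)
    rw [hw] at h
    exact (mul_nonneg_iff_of_pos_left (inv_pos.2 hσ0)).1 h

end StronglySimple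

/-- On the line, a single inequality suffices: the product of an irredundant system of constraints is
nonnegative only on the polyhedron.  Indeed, if some constraint were negative and another one
nonpositive at a point, then the point would be a combination with nonpositive coefficients of the two
points of the cone at which these constraints are active. -/
theorem nonneg_of_prod_nonneg {ι : Type*} [Fintype ι] {L : ι → ((Fin 1 → ℝ) × ℝ) →ₗ[ℝ] ℝ}
    (hs : ∀ u, (∀ i, 0 ≤ L i u) → 0 ≤ u.2) (hP : HasDim {x | ∀ i, 0 ≤ L i (x, 1)} 1)
    (hirr : ∀ i, ∃ u, L i u < 0 ∧ ∀ j, j ≠ i → 0 ≤ L j u) {x : Fin 1 → ℝ}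
    (hx : 0 ≤ ∏ i, L i (x, 1)) (i : ι) : 0 ≤ L i (x, 1) := by
  classical
  by_contra hi
  push Not at hi
  obtain ⟨j, hji, hj⟩ : ∃ j, j ≠ i ∧ L j (x, 1) ≤ 0 := by
    by_contra hcon
    push Not at hcon
    rw [← Finset.mul_prod_erase _ _ (Finset.mem_univ i)] at hx
    have := Finset.prod_pos fun j (hj : j ∈ Finset.univ.erase i) => hcon j (Finset.ne_of_mem_erase hj)
    exact (mul_neg_of_neg_of_pos hi this).not_ge hx
  choose w hw0 hw using exists_facet_point hP hirr
  have hw2 : ∀ k, 0 ≤ (w k).2 := fun k => hs _ fun l => by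
    by_cases h : l = k
    · rw [h, hw0]
    · exact (hw k l h).le
  have ha := hw i j hji
  have hb := hw j i hji.symm
  have hinj : Function.Injective ((L i).prod (L j)) := by
    rw [LinearMap.injective_iff_surjective_of_finrank_eq_finrank (by simp)]
    rintro ⟨s, t⟩
    refine ⟨(t / L j (w i)) • w i + (s / L i (w j)) • w j, ?_⟩
    ext
    · simp [hw0, hb.ne']
    · simp [hw0, ha.ne']
  have hcomb : ((x, 1) : (Fin 1 → ℝ) × ℝ) =
      (L j (x, 1) / L j (w i)) • w i + (L i (x, 1) / L i (w j)) • w j := by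
    refine hinj (Prod.ext ?_ ?_)
    · simp [hw0, hb.ne']
    · simp [hw0, ha.ne']
  have h1 := congrArg Prod.snd hcomb
  simp only [Prod.snd_add, Prod.smul_snd, smul_eq_mul] at h1
  have h2 := mul_nonpos_of_nonpos_of_nonneg (div_nonpos_of_nonpos_of_nonneg hj ha.le) (hw2 i)
  have h3 := mul_nonpos_of_nonpos_of_nonneg (div_nonpos_of_nonpos_of_nonneg hi.le hb.le) (hw2 j)
  linarith

namespace StronglySimple

open LinForm

theorem length_describe_le (d : ℕ) (ls : List LinForm) : (describe d ls).length ≤ d ^ d := by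
  unfold describe
  rw [List.length_append, List.length_map, List.length_range]
  rcases lt_or_ge d 2 with hd | hd
  · rw [if_neg]
    · interval_cases d <;> simp
    · have : (d : ℝ) ≤ 1 := by exact_mod_cast Nat.le_of_lt_succ hd
      linarith
  · refine le_trans (b := d + 2) ?_ ?_
    · split_ifs <;> simp
    · calc d + 2 ≤ d ^ 2 := by nlinarith
        _ ≤ d ^ d := Nat.pow_le_pow_right (by omega) hd

theorem mem_polySet_construct_iff {d : ℕ} (H : List (List ℝ × ℝ)) (x : Fin d → ℝ) :
    x ∈ polySet ((construct (d, H)).map (decodePoly d)) ↔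
      ∀ p ∈ describe d (reduce (d + 1) (coneForms H)), 0 ≤ WordPoly.eval (homPoint x) p := by
  unfold polySet construct
  simp only [List.map_map, Set.mem_ofPred_eq, List.forall_mem_map, Function.comp_apply,
    eval_decodePoly_toExponents]

theorem mem_hPolyhedron_iff {d m : ℕ} (a : Fin m → Fin d → ℝ) (b : Fin m → ℝ) (x : Fin d → ℝ) :
    x ∈ hPolyhedron a b ↔ ∀ l ∈ coneForms (encodeH a b), 0 ≤ eval (homPoint x) l := by
  rw [coneForms_nonneg_iff]
  simp [hPolyhedron, homPoint, dotProduct]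

theorem hPolyhedron_eq_polySet {d m : ℕ} (a : Fin m → Fin d → ℝ) (b : Fin m → ℝ)
    (hdim : HasDim (hPolyhedron a b) d) (hss : IsStronglySimple (hPolyhedron a b)) :
    hPolyhedron a b = polySet ((construct (d, encodeH a b)).map (decodePoly d)) := by
  ext x
  rw [mem_polySet_construct_iff]
  obtain ⟨hsupp, hirr, hiff⟩ := reduce_spec (suppBelow_coneForms a b)
  set ls := reduce (d + 1) (coneForms (encodeH a b)) with hls
  have hP : ∀ x, x ∈ hPolyhedron a b ↔ ∀ l ∈ ls, 0 ≤ eval (homPoint x) l := fun x => by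
    rw [mem_hPolyhedron_iff, hiff]
  let L : Fin ls.length → ((Fin d → ℝ) × ℝ) →ₗ[ℝ] ℝ := fun i => functional ls[i]
  have hLsupp : ∀ i : Fin ls.length, SuppBelow (d + 1) ls[i] := fun i =>
    hsupp _ (List.getElem_mem _)
  have hL : ∀ (u : ℕ → ℝ) i, L i (fun k => u (k + 1), u 0) = eval u ls[i] := fun u i =>
    functional_eq_eval (hLsupp i) u
  have hLx : ∀ x i, L i (x, 1) = eval (homPoint x) ls[i] := fun x i =>
    functional_eq_eval_homPoint (hLsupp i) x
  have hforall : ∀ p : LinForm → Prop, (∀ l ∈ ls, p l) ↔ ∀ i : Fin ls.length, p ls[i] :=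
    fun p => ⟨fun h i => h _ (List.getElem_mem _), fun h l hl => by
      obtain ⟨i, hi, rfl⟩ := List.getElem_of_mem hl
      exact h ⟨i, hi⟩⟩
  have hPL : hPolyhedron a b = {x | ∀ i, 0 ≤ L i (x, 1)} := by
    ext x
    rw [hP, hforall]
    simp only [hLx, Set.mem_ofPred_eq]
  have hs : ∀ u, (∀ i, 0 ≤ L i u) → 0 ≤ u.2 := fun u hu => by
    have h : ∀ l ∈ ls, 0 ≤ eval (homSeq u) l := (hforall _).2 hu
    exact ((coneForms_nonneg_iff a b _).1 ((hiff _).1 h)).1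
  have hirrL : ∀ i, ∃ u, L i u < 0 ∧ ∀ j, j ≠ i → 0 ≤ L j u := fun i => by
    obtain ⟨u, hu, hj⟩ := hirr.exists_getElem i
    refine ⟨(fun k => u (k + 1), u 0), ?_, fun j hji => ?_⟩
    · rwa [hL]
    · rw [hL]
      exact hj j hji
  constructor
  · intro hx p hp
    have hx := (hP x).1 hx
    rcases List.mem_append.1 hp with hp | hp
    · obtain ⟨j, -, rfl⟩ := List.mem_map.1 hp
      rw [WordPoly.eval_coSym]
      refine List.coSym_nonneg (fun y hy => ?_) j
      obtain ⟨l, hl, rfl⟩ := List.mem_map.1 hy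
      exact hx l hl
    · split_ifs at hp
      · simp only [List.mem_cons, List.not_mem_nil, or_false] at hp
        rcases hp with rfl | rfl
        · rw [WordPoly.eval_ofForm, eval_flatten]
          refine List.sum_nonneg fun y hy => ?_
          obtain ⟨l, hl, rfl⟩ := List.mem_map.1 hy
          exact hx l hl
        · exact shell_nonneg hx _
      · simp at hp
  · intro hx
    have hsym : ∀ j < d, 0 ≤ List.coSym j (ls.map (eval (homPoint x))) := fun j hj => by
      rw [← WordPoly.eval_coSym]
      exact hx _ (List.mem_append_left _ (List.mem_map_of_mem (List.mem_range.2 hj)))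
    rcases lt_or_ge d 2 with hd | hd
    · obtain rfl | rfl : d = 0 ∨ d = 1 := by omega
      · obtain ⟨y, hy⟩ := hdim.1
        rwa [Subsingleton.elim x y]
      · rw [hPL] at hdim
        rw [hPL]
        refine nonneg_of_prod_nonneg hs hdim hirrL ?_
        have h := hsym 0 one_pos
        rw [List.coSym_zero, ← Fin.prod_univ_fun_getElem] at h
        exact h.trans_eq (Finset.prod_congr rfl fun i _ => (hLx x i).symm)
    · have h2 : (0 : ℝ) < d - 1 := by
        have : (2 : ℝ) ≤ d := by exact_mod_cast hd
        linarith
      rw [hP]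
      refine nonneg_of_describe hsupp (fun v hv hv1 => ?_) hsym ?_
        (hx _ (List.mem_append_right _ (by rw [if_pos h2]; simp)))
      · rw [List.countP_eq_card_filter]
        rw [hPL] at hdim hss
        have hcard := hss.encard_active_le (by omega) hs hdim hirrL
          (u := (fun k => v (k + 1), v 0))
          (fun i => by rw [hL]; exact hv _ (List.getElem_mem _))
          (fun h0 => by
            have : ∀ l ∈ ls, eval v l = 0 := (hforall _).2 fun i => by
              rw [← hL, h0, map_zero]
            rw [eval_flatten, List.sum_eq_zero fun y hy => by
              obtain ⟨l, hl, rfl⟩ := List.mem_map.1 hy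
              exact this l hl] at hv1
            linarith)
        simp only [hL] at hcard
        have hset : {i : Fin ls.length | eval v ls[i] = 0} =
            ((Finset.univ.filter fun i : Fin ls.length => eval v ls[i] = 0 : Finset _) :
              Set (Fin ls.length)) := by
          ext i
          simp
        rw [hset, Set.encard_coe_eq_coe_finsetCard] at hcard
        exact_mod_cast hcard
      · rw [← WordPoly.eval_ofForm]
        exact hx _ (List.mem_append_right _ (by rw [if_pos h2]; simp))

end StronglySimple

/-- There is an algorithm in the real-number model which turns every H-representation of a
`d`-dimensional strongly simple polyhedron `P` into at most `d ^ d` polynomials describing `P`. -/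
theorem corollary4p1 :
    ∃ construct : ℕ × List (List ℝ × ℝ) → List (List (ℝ × List ℕ)),
      RealComputable construct ∧
      ∀ (d m : ℕ) (a : Fin m → Fin d → ℝ) (b : Fin m → ℝ),
        HasDim (hPolyhedron a b) d → IsStronglySimple (hPolyhedron a b) →
        (construct (d, encodeH a b)).length ≤ d ^ d ∧
        hPolyhedron a b = polySet ((construct (d, encodeH a b)).map (decodePoly d)) := by
  refine ⟨StronglySimple.construct, RealComputable.construct_computable,
    fun d m a b hdim hss => ⟨?_, StronglySimple.hPolyhedron_eq_polySet a b hdim hss⟩⟩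
  rw [StronglySimple.construct, List.length_map]
  exact StronglySimple.length_describe_le d _
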